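/- Let $\mathbf Z$, $\mathbf H$, $\mathbf X$ be real separable Hilbert spaces with $\dim\mathbf Z<\infty$, $\dim \mathbf H=\infty$, and let $\mathbf H\hookrightarrow\mathbf X$ be a dense Hilbert–Schmidt embedding $\iota$, so that $\mathbb C:=\iota\iota^*\colon\mathbf X\to\mathbf X$ is positive definite and trace class and $\mathbf H=\mathbb C^{1/2}\mathbf X$. Let $\mathbf W\subset\mathbf H$ be a finite-dimensional subspace, let $\mathsf C\colon\mathbf Z\to\mathbf H$ be bounded and linear with range in $\mathbf W$, let $\beta>0$ and $\mathcal E_0\in\mathbb R$, and let $\mathcal H_{\mathcal A}\in C^2(\mathbf Z;\mathbb R)$ have a globally Lipschitz derivative and satisfy $\exp\big(-\beta(\mathcal H_{\mathcal A}(z)-\tfrac12\|\mathsf Cz\|_{\mathbf H}^2)\big)\in L^1(\mathbf Z)$. Put $$\mathcal H_{\mathrm{total}}(z,\eta)=\mathcal H_{\mathcal A}(z)+\tfrac12\|\eta\|_{\mathbf H}^2+(\mathsf Cz\,|\,\eta)_{\mathbf H},\qquad (z,\eta)\in\mathbf Z\times\mathbf H .$$ Let $\Xi_1\subset\Xi_2\subset\cdots\subset\mathbf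 W^\perp$ be subspaces with $\dim\Xi_n=n$ whose union is dense in $\mathbf W^\perp$, and set $\mathbf H_n:=\mathbf W+\Xi_n$. For a continuous function $f$ on a finite-dimensional Hilbert space $E$ with Lebesgue measure $\mathrm dx$, and $a\in\mathbb R$, let $\delta[f(x)-a](\mathrm dx)$ denote the locally finite measure on $E$ given, whenever it exists, by $$\int_E F(x)\,\delta[f(x)-a](\mathrm dx)=\lim_{h\downarrow0}\frac1h\int_E F(x)\,\mathbf 1\{a\le f(x)<a+h\}\,\mathrm dx\qquad\text{for all }F\in C_c(E).$$ Then for all sufficiently large $n$ the following holds: on $\mathbf Z\times\mathbf H_n$ the measures $\delta[\mathcal H_{\mathrm{total}}(z,\eta)-a](\mathrm dz\,\mathrm d\eta)$ exist for all $a\in\mathbb R$; they satisfy $$\int_{\mathbb R} G(a)\int F\,\mathrm d\delta[\mathcal H_{\mathrm{total}}-a]\,\mathrm da=\int_{\mathbf Z\times\mathbf H_n} G(\mathcal H_{\mathrm{total}})\,F\,\mathrm dz\,\mathrm d\eta$$ for all $F\in C_c(\mathbf Z\times \mathbf H_n)$ and $G\in C(\mathbb R)$; and for $a=\frac n{2\beta}+\mathcal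 E_0$ the total mass is positive and finite. Hence the normalized microcanonical measure $$\mu_{\beta,n}(\mathrm dz\,\mathrm d\eta):=\frac1{\mathsf Z_n}\,\delta\Big[\mathcal H_{\mathrm{total}}(z,\eta)-\frac n{2\beta}-\mathcal E_0\Big](\mathrm dz\,\mathrm d\eta)$$ is a well-defined probability measure on $\mathbf Z\times\mathbf H_n$, where $\mathsf Z_n$ is its total mass before normalization. As $n\to\infty$, the measures $\mu_{\beta,n}$, regarded as measures on $\mathbf Z\times\mathbf X$, converge weakly (in duality with bounded continuous functions on $\mathbf Z\times\mathbf X$) to the canonical probability measure $$\mu_\beta(\mathrm dz\,\mathrm d\eta)=\frac1{\mathsf Z_\beta}\exp\Big(-\beta\big(\mathcal H_{\mathcal A}(z)-\tfrac12\|\mathsf Cz\|_{\mathbf H}^2\big)\Big)\mathrm dz\;\mathcal N_{\mathbf X}(-\mathsf Cz,\beta^{-1}\mathbb C)(\mathrm d\eta),$$ where $\mathcal N_{\mathbf X}(m,S)$ is the Gaussian measure on $\mathbf X$ with mean $m$ and covariance operator $S$ (which exists for $S=\beta^{-1}\mathbb C$), and $\mathsf Z_\beta$ is the normalization constant. -/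

import Mathlib

open MeasureTheory ProbabilityTheory Filter Topology

namespace HeatBath

/-! ### Microcanonical measures -/

section Delta

variable {E : Type*} [TopologicalSpace E] [MeasureSpace E]

/-- `μ` is the measure `δ[f(x) - a](dx)`: it is finite on compact sets and, for every continuous
compactly supported `F`, the integral `∫ F dμ` is the limit as `h ↓ 0` of
`h⁻¹ ∫ F(x) 1{a ≤ f(x) < a + h} dx`. Such a `μ` is unique on the finite-dimensional spaces
considered here. -/
def IsPDelta (f : E → ℝ) (a : ℝ) (μ : Measure E) : Prop :=
  IsFiniteMeasureOnCompacts μ ∧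
    ∀ F : E → ℝ, Continuous F → HasCompactSupport F →
      Tendsto (fun h : ℝ => h⁻¹ * ∫ x in {x | a ≤ f x ∧ f x < a + h}, F x)
        (𝓝[>] 0) (𝓝 (∫ x, F x ∂μ))

open Classical in
/-- The measure `δ[f(x) - a](dx)`; it is set to `0` where no measure satisfies `IsPDelta`. -/
noncomputable def pdelta (f : E → ℝ) (a : ℝ) : Measure E :=
  if h : ∃ μ : Measure E, IsPDelta f a μ then h.choose else 0

/-- The family `a ↦ δ a` disintegrates Lebesgue measure along `f`:
`∫ G(a) ∫ F dδ_a da = ∫ G(f(x)) F(x) dx`. -/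
def IsDisintegration (f : E → ℝ) (δ : ℝ → Measure E) : Prop :=
  ∀ F : E → ℝ, Continuous F → HasCompactSupport F → ∀ G : ℝ → ℝ, Continuous G →
    ∫ a : ℝ, G a * ∫ x, F x ∂(δ a) = ∫ x, G (f x) * F x

end Delta

/-- A measure divided by its total mass. -/
noncomputable def normalized {E : Type*} [MeasurableSpace E] (μ : Measure E) : Measure E :=
  (μ Set.univ)⁻¹ • μ

/-! ### Gaussian measures on a Hilbert space -/

section Gaussian

variable {X : Type*} [NormedAddCommGroup X] [InnerProductSpace ℝ X]

/-- A bounded operator on a separable Hilbert space is Hilbert-Schmidt if it is square summable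
along every orthonormal sequence. -/
def IsHilbertSchmidt {H : Type*} [NormedAddCommGroup H] [InnerProductSpace ℝ H]
    (T : H →L[ℝ] X) : Prop :=
  ∀ v : ℕ → H, Orthonormal ℝ v → Summable fun k => ‖T (v k)‖ ^ 2

variable [MeasurableSpace X]

/-- `γ` is the centered Gaussian measure with covariance operator `S`:
`⟨x, η⟩ ∼ N(0, ⟨S x, x⟩)` for all `x`. -/
def IsCenteredGaussian (S : X →L[ℝ] X) (γ : Measure X) : Prop :=
  IsFiniteMeasure γ ∧
    ∀ x : X, γ.map (fun η => inner ℝ x η) = gaussianReal 0 (inner ℝ (S x) x).toNNReal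

open Classical in
/-- The centered Gaussian measure `N(0, S)`; it is set to `0` if there is none. -/
noncomputable def centeredGaussian (S : X →L[ℝ] X) : Measure X :=
  if h : ∃ γ : Measure X, IsCenteredGaussian S γ then h.choose else 0

instance (S : X →L[ℝ] X) : IsFiniteMeasure (centeredGaussian S) := by
  unfold centeredGaussian
  split_ifs with h
  · exact h.choose_spec.1
  · infer_instance

/-- The Gaussian measure `N(m, S)`, the translate of `N(0, S)` by `m`. -/
noncomputable def gaussian (m : X) (S : X →L[ℝ] X) : Measure X :=
  (centeredGaussian S).map (fun η => m + η)

variable [BorelSpace X] [SecondCountableTopology X]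

/-- The kernel `z ↦ N(m z, S)` for a measurable function `m`. -/
noncomputable def gaussianKernel {Z : Type*} [MeasurableSpace Z] (m : Z → X)
    (hm : Measurable m) (S : X →L[ℝ] X) : Kernel Z X where
  toFun z := gaussian (m z) S
  measurable' := by
    refine Measure.measurable_of_measurable_coe _ fun s hs => ?_
    have h : MeasurableSet {p : Z × X | m p.1 + p.2 ∈ s} :=
      ((hm.comp measurable_fst).add measurable_snd) hs
    have h' := measurable_measure_prodMk_left (ν := centeredGaussian S) h
    convert h' using 2 with z
    unfold gaussian
    rw [Measure.map_apply (measurable_const_add _) hs]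
    rfl

end Gaussian

/-! ### The coupled system -/

section System

variable {Z H X : Type*}
  [NormedAddCommGroup Z] [InnerProductSpace ℝ Z] [FiniteDimensional ℝ Z]
  [MeasurableSpace Z] [BorelSpace Z]
  [NormedAddCommGroup H] [InnerProductSpace ℝ H]
  [MeasurableSpace H] [BorelSpace H]
  [NormedAddCommGroup X] [InnerProductSpace ℝ X]
  [MeasurableSpace X]

/-- The total Hamiltonian `H_A(z) + ‖η‖² / 2 + ⟨C z, η⟩`. -/
noncomputable def Htotal (HA : Z → ℝ) (C : Z →L[ℝ] H) (z : Z) (η : H) : ℝ :=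
  HA z + ‖η‖ ^ 2 / 2 + inner ℝ (C z) η

/-- The total Hamiltonian restricted to `Z × K` for a subspace `K` of the heat-bath space. -/
noncomputable def HtotalOn (HA : Z → ℝ) (C : Z →L[ℝ] H) (K : Submodule ℝ H) : Z × K → ℝ :=
  fun p => Htotal HA C p.1 (p.2 : H)

/-- The normalized microcanonical measure on `Z × K` with total energy `a`. -/
noncomputable def microcanonical (HA : Z → ℝ) (C : Z →L[ℝ] H) (K : Submodule ℝ H)
    [FiniteDimensional ℝ K] (a : ℝ) : Measure (Z × K) :=
  normalized (pdelta (HtotalOn HA C K) a)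

/-- The microcanonical measure regarded as a measure on `Z × X` through the embedding `ι`. -/
noncomputable def microcanonicalX (HA : Z → ℝ) (C : Z →L[ℝ] H) (ι : H →L[ℝ] X)
    (K : Submodule ℝ H) [FiniteDimensional ℝ K] (a : ℝ) : Measure (Z × X) :=
  (microcanonical HA C K a).map (fun p => (p.1, ι (p.2 : H)))

/-- The probability measure on `Z` with density proportional to
`exp (-β (H_A(z) - ‖C z‖² / 2))`. -/
noncomputable def muZ (β : ℝ) (HA : Z → ℝ) (C : Z →L[ℝ] H) : Measure Z :=
  normalized ((volume : Measure Z).withDensity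
    fun z => ENNReal.ofReal (Real.exp (-β * (HA z - ‖C z‖ ^ 2 / 2))))

variable [CompleteSpace H] [CompleteSpace X] [BorelSpace X] [SecondCountableTopology X]

/-- The covariance operator `β⁻¹ ι ι*` on `X`. -/
noncomputable def bathCov (β : ℝ) (ι : H →L[ℝ] X) : X →L[ℝ] X :=
  β⁻¹ • (ι ∘L ContinuousLinearMap.adjoint ι)

/-- The canonical measure `μ_β(dz dη) = muZ(dz) N(-C z, β⁻¹ ι ι*)(dη)` on `Z × X`. -/
noncomputable def canonical (β : ℝ) (HA : Z → ℝ) (C : Z →L[ℝ] H) (ι : H →L[ℝ] X) :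
    Measure (Z × X) :=
  muZ β HA C ⊗ₘ gaussianKernel (fun z => -ι (C z))
    ((ι.continuous.comp C.continuous).neg.measurable) (bathCov β ι)

end System

end HeatBath

/-! Completing the square gives H_total = V(z) + ‖η + Cz‖²/2 with V = H_A - ‖Cz‖²/2
(`HtotalOn_eq_shiftedEnergy`). Put K = W + Ξ_n and N = dim K = w + n. Over each z the energy surface
of level a is a sphere in K with centre -Cz and radius r = √(2(a - V(z))). Polar coordinates and r
dr = da turn r^(N-1) dr into r^(N-2) da. The microcanonical measure is therefore r^(N-2) dz dω, with
dω the area of the unit sphere (`isPDelta_shellMeasure`).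

Two limits remain. Weights: for a = n/(2β) + E₀ the density r^(N-2) is, up to a factor free of z, (1
+ 2x/n)^((N-2)/2) with x = β(E₀ - V(z)). It tends to exp x and is bounded by a constant times exp x,
uniformly in n (`tendsto_sqrt_one_add_div_pow`, `sqrt_one_add_div_pow_le`). Dominated convergence in
z then applies. Fibres: r/√N → β^(-1/2) for every z, and Poincaré's lemma turns the uniform law on
the sphere into a Gaussian (`tendsto_integral_sphereUniform`). A uniform direction is g/‖g‖ with g
standard Gaussian, and ‖g‖²/N → 1 by the law of large numbers. In a Hilbert basis adapted to all the
K at once (`exists_adapted_hilbertBasis`), one sequence of normal variables serves every n. The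
Hilbert–Schmidt property makes the images ι g converge in X, to a vector with covariance ιι*
(`isCenteredGaussian_map_series`). -/

open MeasureTheory ProbabilityTheory Filter Topology

namespace HeatBath

set_option linter.unusedSectionVars false

/-! ### Energy shells: explicit surface measure and disintegration of Lebesgue measure. -/

section Shell

open Metric Set Measure

/-- The radius `√(2 (a - v))` of the energy sphere at energy `a` and potential `v`. -/
noncomputable def shellRadius (a v : ℝ) : ℝ := √(2 * (a - v))

lemma shellRadius_nonneg (a v : ℝ) : 0 ≤ shellRadius a v := Real.sqrt_nonneg _

lemma continuous_shellRadius : Continuous fun p : ℝ × ℝ => shellRadius p.1 p.2 := by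
  unfold shellRadius; fun_prop

section Polar

variable {E : Type*} [NormedAddCommGroup E] [InnerProductSpace ℝ E] [FiniteDimensional ℝ E]
  [MeasurableSpace E] [BorelSpace E]

/-- Integration in polar coordinates. -/
lemma lintegral_polar [Nontrivial E] (f : E → ENNReal) (hf : Measurable f) :
    ∫⁻ x, f x = ∫⁻ ω : sphere (0 : E) 1, (∫⁻ r in Ioi (0 : ℝ),
      ENNReal.ofReal (r ^ (Module.finrank ℝ E - 1)) * f (r • (ω : E)))
        ∂(volume : Measure E).toSphere := by
  have hmp := (volume : Measure E).measurePreserving_homeomorphUnitSphereProd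
  have h1 : ∫⁻ x, f x = ∫⁻ x in ({0}ᶜ : Set E), f x := by
    rw [restrict_compl_singleton]
  have h2 : ∫⁻ x in ({0}ᶜ : Set E), f x
      = ∫⁻ x : ({0}ᶜ : Set E), f x ∂(volume.comap Subtype.val) := by
    rw [lintegral_subtype_comap (measurableSet_singleton _).compl]
  have h3 : ∫⁻ x : ({0}ᶜ : Set E), f x ∂(volume.comap Subtype.val)
      = ∫⁻ p, f ((p.2 : ℝ) • (p.1 : E))
        ∂((volume : Measure E).toSphere.prod (volumeIoiPow (Module.finrank ℝ E - 1))) := by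
    rw [← hmp.map_eq, lintegral_map (by fun_prop) (Homeomorph.measurable _)]
    refine lintegral_congr fun x => ?_
    have hx : ‖(x : E)‖ ≠ 0 := norm_ne_zero_iff.2 x.2
    simp [smul_smul, hx]
  rw [h1, h2, h3, lintegral_prod _ (by fun_prop)]
  refine lintegral_congr fun ω => ?_
  rw [volumeIoiPow, lintegral_withDensity_eq_lintegral_mul _ (by fun_prop) (by fun_prop)]
  simp only [Pi.mul_apply]
  rw [← lintegral_subtype_comap measurableSet_Ioi
    (fun r : ℝ => ENNReal.ofReal (r ^ (Module.finrank ℝ E - 1)) * f (r • (ω : E)))]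

/-- Integration in polar coordinates, parametrized by the energy `s = r² / 2`. -/
lemma lintegral_energy (u : ℝ → ENNReal) (v : ℝ) {N : ℕ} (hN : 3 ≤ N) :
    ∫⁻ r in Ioi (0 : ℝ), ENNReal.ofReal (r ^ (N - 1)) * u r
      = ∫⁻ a : ℝ, ENNReal.ofReal (shellRadius a v ^ (N - 2)) * u (shellRadius a v) := by
  have himg : (fun r : ℝ => r ^ 2 / 2 + v) '' Ioi 0 = Ioi v := by
    ext y
    simp only [mem_image, mem_Ioi]
    constructor
    · rintro ⟨r, hr, rfl⟩; have := pow_pos hr 2; linarith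
    · intro hy
      refine ⟨√(2 * (y - v)), Real.sqrt_pos.2 (by linarith), ?_⟩
      rw [Real.sq_sqrt (by linarith)]; ring
  -- For a ≤ v the square root of a nonpositive number is 0 by convention, and so is its positive
  -- power N - 2.
  have hsupp : ∫⁻ a : ℝ, ENNReal.ofReal (shellRadius a v ^ (N - 2)) * u (shellRadius a v)
      = ∫⁻ a in Ioi v, ENNReal.ofReal (shellRadius a v ^ (N - 2)) * u (shellRadius a v) := by
    rw [setLIntegral_eq_of_support_subset]
    intro a ha
    by_contra h
    apply ha
    have : shellRadius a v = 0 := Real.sqrt_eq_zero_of_nonpos (by simp at h; linarith)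
    simp [this, zero_pow (show N - 2 ≠ 0 by omega)]
  rw [hsupp, ← himg, lintegral_image_eq_lintegral_abs_deriv_mul measurableSet_Ioi
    (f' := fun r => r)]
  · refine setLIntegral_congr_fun measurableSet_Ioi fun r hr => ?_
    have hr : 0 < r := hr
    have : shellRadius (r ^ 2 / 2 + v) v = r := by
      unfold shellRadius
      rw [show 2 * (r ^ 2 / 2 + v - v) = r ^ 2 by ring, Real.sqrt_sq hr.le]
    simp only [this]
    rw [← mul_assoc, ← ENNReal.ofReal_mul (abs_nonneg _), abs_of_pos hr, ← pow_succ',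
      show N - 2 + 1 = N - 1 by omega]
  · intro r _
    have := (((hasDerivAt_id r).pow 2).div_const 2).add_const v
    refine HasDerivAt.hasDerivWithinAt ?_
    convert this using 1 <;> simp [id]
  · intro x hx y hy h
    have hx : 0 < x := hx
    have hy : 0 < y := hy
    simp only at h
    have : x ^ 2 = y ^ 2 := by linarith
    exact (pow_left_inj₀ hx.le hy.le two_ne_zero).1 this

end Polar

variable {Z E : Type*}
  [NormedAddCommGroup Z] [InnerProductSpace ℝ Z] [FiniteDimensional ℝ Z]
  [MeasurableSpace Z] [BorelSpace Z]
  [NormedAddCommGroup E] [InnerProductSpace ℝ E] [FiniteDimensional ℝ E]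
  [MeasurableSpace E] [BorelSpace E]

/-- The energy `V z + ‖η - b z‖² / 2`. -/
noncomputable def shiftedEnergy (V : Z → ℝ) (b : Z → E) (p : Z × E) : ℝ :=
  V p.1 + ‖p.2 - b p.1‖ ^ 2 / 2

/-- The parametrization of the energy surface of level `a` by `Z × sphere`. -/
noncomputable def shellParam (V : Z → ℝ) (b : Z → E) (a : ℝ) (p : Z × sphere (0 : E) 1) : Z × E :=
  (p.1, shellRadius a (V p.1) • (p.2 : E) + b p.1)

/-- The density of the surface measure in the parametrization `shellParam`. -/
noncomputable def shellDensity (E : Type*) [NormedAddCommGroup E] [InnerProductSpace ℝ E]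
    (a v : ℝ) : ℝ :=
  shellRadius a v ^ (Module.finrank ℝ E - 2)

lemma shellDensity_nonneg (a v : ℝ) : 0 ≤ shellDensity E a v :=
  pow_nonneg (shellRadius_nonneg _ _) _

lemma continuous_shellDensity : Continuous fun p : ℝ × ℝ => shellDensity E p.1 p.2 :=
  continuous_shellRadius.pow _

/-- The microcanonical surface measure of level `a`. -/
noncomputable def shellMeasure (V : Z → ℝ) (b : Z → E) (a : ℝ) : Measure (Z × E) :=
  (((volume : Measure Z).prod (volume : Measure E).toSphere).withDensity
    fun p => ENNReal.ofReal (shellDensity E a (V p.1))).map (shellParam V b a)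

variable {V : Z → ℝ} {b : Z → E}

lemma continuous_shellParam (hV : Continuous V) (hb : Continuous b) :
    Continuous fun q : ℝ × (Z × sphere (0 : E) 1) => shellParam V b q.1 q.2 := by
  unfold shellParam
  have := continuous_shellRadius.comp
    (continuous_fst.prodMk (hV.comp (continuous_fst.comp continuous_snd)) :
      Continuous fun q : ℝ × (Z × sphere (0 : E) 1) => (q.1, V q.2.1))
  simp only [Function.comp_def] at this
  fun_prop

lemma continuous_shellDensity_comp (hV : Continuous V) :
    Continuous fun q : ℝ × (Z × sphere (0 : E) 1) => shellDensity E q.1 (V q.2.1) :=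
  continuous_shellDensity.comp
    (continuous_fst.prodMk (hV.comp (continuous_fst.comp continuous_snd)))

lemma shiftedEnergy_shellParam {a : ℝ} {p : Z × sphere (0 : E) 1} (h : V p.1 ≤ a) :
    shiftedEnergy V b (shellParam V b a p) = a := by
  simp only [shiftedEnergy, shellParam, add_sub_cancel_right, norm_smul, norm_eq_of_mem_sphere,
    mul_one, Real.norm_eq_abs, sq_abs, shellRadius]
  rw [Real.sq_sqrt (by linarith)]; ring

/-- This is where dimension at least 3 matters: in dimension 2 the convention 0^0 = 1 would put
spurious mass on levels below the potential. -/
lemma shellDensity_eq_zero (hN : 3 ≤ Module.finrank ℝ E) {a v : ℝ} (h : a ≤ v) :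
    shellDensity E a v = 0 := by
  have : shellRadius a v = 0 := Real.sqrt_eq_zero_of_nonpos (by linarith)
  rw [shellDensity, this, zero_pow (by omega)]

/-- The measures `shellMeasure V b a` disintegrate Lebesgue measure. -/
lemma map_withDensity_shellParam (hV : Continuous V) (hb : Continuous b)
    (hN : 3 ≤ Module.finrank ℝ E) :
    (((volume : Measure ℝ).prod ((volume : Measure Z).prod
        (volume : Measure E).toSphere)).withDensity
      fun q => ENNReal.ofReal (shellDensity E q.1 (V q.2.1))).map
        (fun q => shellParam V b q.1 q.2) = (volume : Measure (Z × E)) := by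
  have : Nontrivial E := Module.nontrivial_of_finrank_pos (R := ℝ) (by omega)
  have hT := (continuous_shellParam hV hb).measurable
  have hD := (continuous_shellDensity_comp (E := E) hV).measurable
  refine Measure.ext_of_lintegral _ fun f hf => ?_
  rw [lintegral_map hf hT]
  erw [lintegral_withDensity_eq_lintegral_mul _ hD.ennreal_ofReal (hf.comp hT)]
  have hm : Measurable fun q : ℝ × (Z × sphere (0 : E) 1) =>
      ENNReal.ofReal (shellDensity E q.1 (V q.2.1)) * f (shellParam V b q.1 q.2) :=
    hD.ennreal_ofReal.mul (hf.comp hT)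
  simp only [Pi.mul_apply, Function.comp_apply]
  -- Tonelli with the energy innermost: for fixed z and ω, the energy integral is a radial integral.
  rw [lintegral_prod_symm _ hm.aemeasurable, lintegral_prod _ hm.lintegral_prod_left'.aemeasurable]
  rw [volume_eq_prod, lintegral_prod _ hf.aemeasurable]
  refine lintegral_congr fun z => ?_
  rw [← lintegral_add_right_eq_self (fun η => f (z, η)) (b z), lintegral_polar _ (by fun_prop)]
  refine lintegral_congr fun ω => ?_
  rw [lintegral_energy (fun r => f (z, r • (ω : E) + b z)) (V z) hN]
  rfl

lemma integral_shellMeasure (hV : Continuous V) (hb : Continuous b) (a : ℝ) {F : Z × E → ℝ}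
    (hF : Continuous F) :
    ∫ x, F x ∂(shellMeasure V b a) = ∫ p : Z × sphere (0 : E) 1,
      shellDensity E a (V p.1) * F (shellParam V b a p)
        ∂((volume : Measure Z).prod (volume : Measure E).toSphere) := by
  have hT : Measurable (shellParam V b a) :=
    ((continuous_shellParam hV hb).comp (Continuous.prodMk_right a)).measurable
  have hD : Measurable fun p : Z × sphere (0 : E) 1 => shellDensity E a (V p.1) :=
    ((continuous_shellDensity_comp (E := E) hV).comp (Continuous.prodMk_right a)).measurable
  rw [shellMeasure, integral_map hT.aemeasurable hF.aestronglyMeasurable]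
  rw [integral_withDensity_eq_integral_toReal_smul hD.ennreal_ofReal (by simp)]
  simp [ENNReal.toReal_ofReal, shellDensity_nonneg]

/-- The integral of a compactly supported continuous function over the energy surface depends
continuously on the energy. -/
lemma continuous_integral_shellMeasure (hV : Continuous V) (hb : Continuous b)
    {F : Z × E → ℝ} (hF : Continuous F) (hFc : HasCompactSupport F) :
    Continuous fun a => ∫ x, F x ∂(shellMeasure V b a) := by
  simp_rw [integral_shellMeasure hV hb _ hF]
  -- The parametrization fixes z and the sphere is compact, so this compact set carries the
  -- integrand for every energy at once.
  set k : Set (Z × sphere (0 : E) 1) := (Prod.fst '' tsupport F) ×ˢ univ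
  have hk : IsCompact k := (hFc.isCompact.image continuous_fst).prod isCompact_univ
  have : ∀ a, ∫ p : Z × sphere (0 : E) 1, shellDensity E a (V p.1) * F (shellParam V b a p)
        ∂((volume : Measure Z).prod (volume : Measure E).toSphere)
      = ∫ p in k, shellDensity E a (V p.1) * F (shellParam V b a p)
        ∂((volume : Measure Z).prod (volume : Measure E).toSphere) := by
    intro a
    rw [setIntegral_eq_integral_of_forall_compl_eq_zero]
    intro p hp
    have : shellParam V b a p ∉ tsupport F := fun h =>
      hp ⟨⟨_, h, rfl⟩, mem_univ _⟩
    rw [image_eq_zero_of_notMem_tsupport this, mul_zero]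
  simp_rw [this]
  refine continuous_parametric_integral_of_continuous (f := fun a (p : Z × sphere (0 : E) 1) =>
    shellDensity E a (V p.1) * F (shellParam V b a p)) ?_ hk
  exact (continuous_shellDensity_comp hV).mul (hF.comp (continuous_shellParam hV hb))

lemma isFiniteMeasureOnCompacts_shellMeasure (hV : Continuous V) (hb : Continuous b) (a : ℝ) :
    IsFiniteMeasureOnCompacts (shellMeasure V b a) := by
  have hT : Measurable (shellParam V b a) :=
    ((continuous_shellParam hV hb).comp (Continuous.prodMk_right a)).measurable
  have hD : Continuous fun p : Z × sphere (0 : E) 1 => shellDensity E a (V p.1) :=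
    (continuous_shellDensity_comp (E := E) hV).comp (Continuous.prodMk_right a)
  refine ⟨fun K hK => ?_⟩
  have hk : IsCompact ((Prod.fst '' K) ×ˢ (univ : Set (sphere (0 : E) 1))) :=
    (hK.image continuous_fst).prod isCompact_univ
  rw [shellMeasure, map_apply hT hK.measurableSet]
  have hsub : shellParam V b a ⁻¹' K ⊆ (Prod.fst '' K) ×ˢ univ :=
    fun p hp => ⟨⟨_, hp, rfl⟩, mem_univ _⟩
  refine (measure_mono hsub).trans_lt ?_
  rw [withDensity_apply _ hk.measurableSet]
  exact (hD.continuousOn.integrableOn_compact hk).lintegral_lt_top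

lemma continuous_shiftedEnergy (hV : Continuous V) (hb : Continuous b) :
    Continuous (shiftedEnergy V b) := by
  unfold shiftedEnergy; fun_prop

/-- The coarea formula. No continuity of G is assumed, because it is also needed for the indicator
of an energy window. -/
lemma integral_comp_energy (hV : Continuous V) (hb : Continuous b)
    (hN : 3 ≤ Module.finrank ℝ E) {F : Z × E → ℝ} (hF : Continuous F) {G : ℝ → ℝ}
    (hi : Integrable fun x => G (shiftedEnergy V b x) * F x) :
    ∫ a, G a * ∫ x, F x ∂(shellMeasure V b a) = ∫ x, G (shiftedEnergy V b x) * F x := by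
  have hT := (continuous_shellParam hV hb).measurable
  have hD := (continuous_shellDensity_comp (E := E) hV).measurable
  have hvol := map_withDensity_shellParam hV hb hN
  have hi' := hi
  rw [← hvol] at hi'
  rw [integrable_map_measure (by rw [hvol]; exact hi.aestronglyMeasurable) hT.aemeasurable,
    integrable_withDensity_iff_integrable_smul' hD.ennreal_ofReal (by simp)] at hi'
  have hcongr : (fun q : ℝ × (Z × sphere (0 : E) 1) =>
      (ENNReal.ofReal (shellDensity E q.1 (V q.2.1))).toReal •
        ((fun x => G (shiftedEnergy V b x) * F x) ∘ fun q => shellParam V b q.1 q.2) q)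
      = fun q => G q.1 * (shellDensity E q.1 (V q.2.1) * F (shellParam V b q.1 q.2)) := by
    ext q
    rw [ENNReal.toReal_ofReal (shellDensity_nonneg _ _)]
    rcases le_total (V q.2.1) q.1 with h | h
    · simp only [Function.comp, shiftedEnergy_shellParam h, smul_eq_mul]; ring
    · simp [shellDensity_eq_zero hN h]
  rw [hcongr] at hi'
  conv_rhs => rw [← hvol]
  rw [integral_map hT.aemeasurable (by rw [hvol]; exact hi.aestronglyMeasurable),
    integral_withDensity_eq_integral_toReal_smul hD.ennreal_ofReal (by simp)]
  have h2 := integral_prod _ hi'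
  simp_rw [integral_const_mul, ← integral_shellMeasure hV hb _ hF] at h2
  rw [← h2]
  exact congrArg (fun u => ∫ q, u q ∂_) hcongr.symm

lemma isDisintegration_shellMeasure (hV : Continuous V) (hb : Continuous b)
    (hN : 3 ≤ Module.finrank ℝ E) :
    IsDisintegration (shiftedEnergy V b) (shellMeasure V b) := by
  intro F hF hFc G hG
  refine (integral_comp_energy hV hb hN hF ?_)
  exact ((hG.comp (continuous_shiftedEnergy hV hb)).mul hF).integrable_of_hasCompactSupport
    hFc.mul_left

/-- By the coarea formula, the quotient in the definition is the mean over [a, a + h) of a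
continuous function of the energy; the fundamental theorem of calculus gives its limit for every a.
-/
lemma isPDelta_shellMeasure (hV : Continuous V) (hb : Continuous b)
    (hN : 3 ≤ Module.finrank ℝ E) (a : ℝ) :
    IsPDelta (shiftedEnergy V b) a (shellMeasure V b a) := by
  refine ⟨isFiniteMeasureOnCompacts_shellMeasure hV hb a, fun F hF hFc => ?_⟩
  set Φ : ℝ → ℝ := fun a => ∫ x, F x ∂(shellMeasure V b a) with hΦdef
  have hΦ : Continuous Φ := continuous_integral_shellMeasure hV hb hF hFc
  have hd : HasDerivAt (fun t => ∫ s in a..t, Φ s) (Φ a) a :=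
    (hΦ.integral_hasStrictDerivAt a a).hasDerivAt
  refine hd.tendsto_slope_zero_right.congr' ?_
  filter_upwards [self_mem_nhdsWithin] with h hh
  have hh : 0 < h := hh
  simp only [intervalIntegral.integral_same, sub_zero, smul_eq_mul]
  congr 1
  have hms : MeasurableSet {x | a ≤ shiftedEnergy V b x ∧ shiftedEnergy V b x < a + h} :=
    (continuous_shiftedEnergy hV hb).measurable measurableSet_Ico
  have hind : (fun x => (Ico a (a + h)).indicator 1 (shiftedEnergy V b x) * F x)
      = {x | a ≤ shiftedEnergy V b x ∧ shiftedEnergy V b x < a + h}.indicator F := by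
    ext x
    by_cases hx : a ≤ shiftedEnergy V b x ∧ shiftedEnergy V b x < a + h <;>
      simp [indicator, hx]
  have hind' : (fun s => (Ico a (a + h)).indicator 1 s * Φ s) = (Ico a (a + h)).indicator Φ := by
    ext s
    by_cases hs : a ≤ s ∧ s < a + h <;> simp [indicator, hs]
  have hkey := (integral_comp_energy hV hb hN hF
    (G := (Ico a (a + h)).indicator 1) ?_)
  · rw [intervalIntegral.integral_of_le (by linarith), integral_Ioc_eq_integral_Ioo,
      ← integral_Ico_eq_integral_Ioo, ← integral_indicator measurableSet_Ico,
      ← integral_indicator hms, ← hind, ← hind']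
    exact hkey
  · rw [hind]
    exact (hF.integrable_of_hasCompactSupport hFc (μ := volume)).indicator hms

end Shell

/-- The measure `δ[f(x) - a](dx)` is unique. -/
lemma IsPDelta.unique {E : Type*} [TopologicalSpace E] [T2Space E] [LocallyCompactSpace E]
    [SecondCountableTopology E] [MeasureSpace E] [BorelSpace E] {f : E → ℝ} {a : ℝ}
    {μ ν : Measure E} (hμ : IsPDelta f a μ) (hν : IsPDelta f a ν) : μ = ν := by
  have := hμ.1
  have := hν.1
  refine Measure.ext_of_integral_eq_on_compactlySupported fun F => ?_
  exact tendsto_nhds_unique (hμ.2 F F.continuous F.hasCompactSupport)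
    (hν.2 F F.continuous F.hasCompactSupport)

lemma isPDelta_pdelta {E : Type*} [TopologicalSpace E] [MeasureSpace E] {f : E → ℝ} {a : ℝ}
    {μ : Measure E} (hμ : IsPDelta f a μ) : IsPDelta f a (pdelta f a) := by
  have h : ∃ μ, IsPDelta f a μ := ⟨μ, hμ⟩
  rw [pdelta, dif_pos h]
  exact h.choose_spec

/-! ### Gaussian vectors and the uniform measure on the sphere. -/

section Sphere

open Metric Set Measure

variable {E : Type*} [NormedAddCommGroup E] [InnerProductSpace ℝ E] [FiniteDimensional ℝ E]
  [MeasurableSpace E] [BorelSpace E]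

/-- The standard Gaussian measure has a density proportional to `exp (-‖x‖² / 2)`. -/
lemma exists_stdGaussian_eq_withDensity : ∃ c : ℝ, 0 < c ∧
    stdGaussian E = (volume : Measure E).withDensity
      fun x => ENNReal.ofReal (c * Real.exp (-(1 / 2) * ‖x‖ ^ 2)) := by
  set A : ℝ := ∫ v : E, Real.exp (-(1 / 2) * ‖v‖ ^ 2) with hA
  have hA' : A = (Real.pi / (1 / 2)) ^ (Module.finrank ℝ E / 2 : ℝ) :=
    GaussianFourier.integral_rexp_neg_mul_sq_norm (by norm_num)
  have hA0 : 0 < A := by rw [hA']; positivity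
  have hint : Integrable fun v : E => Real.exp (-(1 / 2) * ‖v‖ ^ 2) := by
    -- The integral of a nonintegrable function is 0 by convention, which contradicts `hA0`.
    by_contra h
    exact hA0.ne' (integral_undef h)
  have hre : 0 < ((1 / 2 : ℂ)).re := by norm_num
  have hAC : (A : ℂ) = (Real.pi / (1 / 2 : ℂ)) ^ (Module.finrank ℝ E / 2 : ℂ) := by
    rw [← GaussianFourier.integral_cexp_neg_mul_sq_norm (V := E) hre, hA, ← integral_complex_ofReal]
    congr with v
    push_cast; rfl
  refine ⟨A⁻¹, inv_pos.2 hA0, ?_⟩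
  have hfin : IsFiniteMeasure ((volume : Measure E).withDensity
      fun x => ENNReal.ofReal (A⁻¹ * Real.exp (-(1 / 2) * ‖x‖ ^ 2))) :=
    isFiniteMeasure_withDensity_ofReal (hint.const_mul _).2
  refine Measure.ext_of_charFun ?_
  ext t
  rw [charFun_stdGaussian, charFun_apply, integral_withDensity_eq_integral_toReal_smul
    (by fun_prop) (by simp)]
  have h := GaussianFourier.integral_cexp_neg_mul_sq_norm_add (V := E) hre Complex.I t
  rw [← hAC] at h
  have h2 : ∀ x : E, (ENNReal.ofReal (A⁻¹ * Real.exp (-(1 / 2) * ‖x‖ ^ 2))).toReal •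
      Complex.exp (inner ℝ x t * Complex.I)
      = (A : ℂ)⁻¹ * Complex.exp (-(1 / 2 : ℂ) * ‖x‖ ^ 2 + Complex.I * inner ℝ t x) := by
    intro x
    rw [ENNReal.toReal_ofReal (by positivity), Complex.exp_add, real_inner_comm, Complex.real_smul]
    push_cast
    rw [mul_comm Complex.I]
    ring
  simp_rw [h2]
  rw [integral_const_mul, h, ← mul_assoc, inv_mul_cancel₀ (by exact_mod_cast hA0.ne'), one_mul]
  congr 1
  rw [Complex.I_sq]
  ring

/-- The direction of a standard Gaussian vector is uniformly distributed on the sphere. -/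
lemma map_stdGaussian_direction [Nontrivial E] :
    (stdGaussian E).map (fun x => ‖x‖⁻¹ • x)
      = ((volume : Measure E).toSphere univ)⁻¹ • (volume : Measure E).toSphere.map Subtype.val := by
  obtain ⟨c, hc, h⟩ := exists_stdGaussian_eq_withDensity (E := E)
  set K : ENNReal := ∫⁻ r in Ioi (0 : ℝ), ENNReal.ofReal (r ^ (Module.finrank ℝ E - 1)) *
    ENNReal.ofReal (c * Real.exp (-(1 / 2) * r ^ 2))
  have hm : Measurable fun x : E => ‖x‖⁻¹ • x := by fun_prop
  have key : ∀ f : E → ENNReal, Measurable f → ∫⁻ x, f x ∂((stdGaussian E).map fun x => ‖x‖⁻¹ • x)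
      = (∫⁻ ω, f ω ∂(volume : Measure E).toSphere) * K := by
    intro f hf
    rw [lintegral_map hf hm, h]
    rw [lintegral_withDensity_eq_lintegral_mul₀ (by fun_prop) (by fun_prop)]
    rw [lintegral_polar _ (by fun_prop)]
    rw [← lintegral_mul_const _ (by fun_prop)]
    refine lintegral_congr fun ω => ?_
    rw [← lintegral_const_mul _ (by fun_prop)]
    refine setLIntegral_congr_fun measurableSet_Ioi fun r hr => ?_
    have hr : 0 < r := hr
    simp only [Pi.mul_apply, norm_smul, norm_eq_of_mem_sphere, Real.norm_eq_abs, abs_of_pos hr,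
      mul_one, smul_smul, inv_mul_cancel₀ hr.ne', one_smul]
    ring
  have hprob : IsProbabilityMeasure ((stdGaussian E).map fun x => ‖x‖⁻¹ • x) :=
    Measure.isProbabilityMeasure_map hm.aemeasurable
  -- Testing with the constant 1 identifies the radial integral K without evaluating it.
  have hone := key 1 measurable_one
  simp only [Pi.one_apply, lintegral_const, measure_univ, mul_one, one_mul] at hone
  have hK : K = ((volume : Measure E).toSphere univ)⁻¹ := by
    refine ENNReal.eq_inv_of_mul_eq_one_left ?_
    rw [mul_comm]; exact hone.symm
  refine Measure.ext_of_lintegral _ fun f hf => ?_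
  rw [key f hf, lintegral_smul_measure, lintegral_map hf measurable_subtype_coe, hK, mul_comm,
    smul_eq_mul]

end Sphere

/-! ### Gaussian series with values in a Hilbert space. -/

section Series

open Measure

/-- The law of a sequence of independent standard normal variables. -/
noncomputable abbrev gaussianSeq : Measure (ℕ → ℝ) := infinitePi fun _ => gaussianReal 0 1

lemma iIndepFun_gaussianSeq : iIndepFun (fun k (ξ : ℕ → ℝ) => ξ k) gaussianSeq :=
  iIndepFun_infinitePi (P := fun _ : ℕ => gaussianReal 0 1) (X := fun _ x => x)
    (fun _ => measurable_id)

lemma map_eval_gaussianSeq (k : ℕ) : gaussianSeq.map (fun ξ => ξ k) = gaussianReal 0 1 :=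
  infinitePi_map_eval (fun _ : ℕ => gaussianReal 0 1) k

/-- A standard Gaussian vector in coordinates with respect to an orthonormal basis. -/
lemma map_gaussianSeq_eq_stdGaussian {E : Type*} [NormedAddCommGroup E] [InnerProductSpace ℝ E]
    [FiniteDimensional ℝ E] [MeasurableSpace E] [BorelSpace E] {N : ℕ}
    (b : OrthonormalBasis (Fin N) ℝ E) :
    gaussianSeq.map (fun ξ => ∑ i : Fin N, ξ i • b i) = stdGaussian E := by
  have h1 : gaussianSeq.map (fun ξ (i : Fin N) => ξ i) = Measure.pi fun _ => gaussianReal 0 1 := by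
    have := map_infinitePi_infinitePi_of_inj (P := fun _ : ℕ => gaussianReal 0 1)
      (f := fun i : Fin N => (i : ℕ)) Fin.val_injective
    rw [this, infinitePi_eq_pi]
  rw [stdGaussian_eq_map_pi_orthonormalBasis b, ← h1, map_map (by fun_prop) (by fun_prop)]
  rfl

lemma memLp_eval_gaussianSeq (k : ℕ) : MemLp (fun ξ : ℕ → ℝ => ξ k) 2 gaussianSeq := by
  have h : MemLp (id : ℝ → ℝ) 2 (gaussianSeq.map fun ξ => ξ k) := by
    rw [map_eval_gaussianSeq]; exact IsGaussian.memLp_two_id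
  exact (memLp_map_measure_iff h.1 (measurable_pi_apply k).aemeasurable).1 h

lemma integral_comp_eval_gaussianSeq (k : ℕ) {f : ℝ → ℝ} (hf : Continuous f) :
    ∫ ξ, f (ξ k) ∂gaussianSeq = ∫ x, f x ∂(gaussianReal 0 1) := by
  rw [← map_eval_gaussianSeq k, integral_map (measurable_pi_apply k).aemeasurable
    hf.aestronglyMeasurable]

lemma integral_eval_sq_gaussianSeq (k : ℕ) : ∫ ξ, ξ k ^ 2 ∂gaussianSeq = 1 := by
  have h := variance_id_gaussianReal (μ := 0) (v := 1)
  rw [variance_eq_integral (by fun_prop)] at h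
  simp only [id, integral_id_gaussianReal, sub_zero] at h
  rw [integral_comp_eval_gaussianSeq k (f := fun x => x ^ 2) (by fun_prop), h]
  rfl

lemma integral_eval_mul_gaussianSeq {i j : ℕ} (hij : i ≠ j) :
    ∫ ξ, ξ i * ξ j ∂gaussianSeq = 0 := by
  rw [(iIndepFun_gaussianSeq.indepFun hij).integral_fun_mul_eq_mul_integral
    (measurable_pi_apply i).aestronglyMeasurable (measurable_pi_apply j).aestronglyMeasurable,
    integral_comp_eval_gaussianSeq i (f := fun x => x) continuous_id, integral_id_gaussianReal,
    zero_mul]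

/-- The squared norm of a standard Gaussian vector in dimension `N` is asymptotic to `N`. -/
lemma tendsto_sum_sq_gaussianSeq : ∀ᵐ ξ ∂gaussianSeq,
    Tendsto (fun n : ℕ => (n : ℝ)⁻¹ * ∑ i ∈ Finset.range n, ξ i ^ 2) atTop (𝓝 1) := by
  have h := strong_law_ae (μ := gaussianSeq) (fun k ξ => ξ k ^ 2)
    (memLp_eval_gaussianSeq 0).integrable_sq ?_ ?_
  · simpa [integral_eval_sq_gaussianSeq] using h
  · intro i j hij
    exact (iIndepFun_gaussianSeq.indepFun hij).comp (φ := fun x => x ^ 2) (ψ := fun x => x ^ 2)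
      (by fun_prop) (by fun_prop)
  · intro i
    have : IdentDistrib (fun ξ : ℕ → ℝ => ξ i) (fun ξ => ξ 0) gaussianSeq gaussianSeq :=
      ⟨(measurable_pi_apply i).aemeasurable, (measurable_pi_apply 0).aemeasurable,
        by rw [map_eval_gaussianSeq, map_eval_gaussianSeq]⟩
    exact this.comp (u := fun x => x ^ 2) (by fun_prop)

variable {X : Type*} [NormedAddCommGroup X] [InnerProductSpace ℝ X] [CompleteSpace X]
  [SecondCountableTopology X] [MeasurableSpace X] [BorelSpace X]

lemma memLp_eval_smul {X : Type*} [NormedAddCommGroup X] [InnerProductSpace ℝ X] (k : ℕ) (x : X) :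
    MemLp (fun ξ : ℕ → ℝ => ξ k • x) 2 gaussianSeq :=
  ((ContinuousLinearMap.id ℝ ℝ).smulRight x).comp_memLp' (memLp_eval_gaussianSeq k)

/-- The isometric embedding `x ↦ ξ_k x` of `X` into `L²`. -/
noncomputable def gaussianIsometry (X : Type*) [NormedAddCommGroup X] [InnerProductSpace ℝ X]
    (k : ℕ) : X →ₗᵢ[ℝ] Lp X 2 gaussianSeq :=
  LinearMap.isometryOfInner
    { toFun := fun x => (memLp_eval_smul k x).toLp
      map_add' := by
        intro x y
        rw [← MemLp.toLp_add]
        congr 1 with ξ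
        simp
      map_smul' := by
        intro c x
        rw [RingHom.id_apply, ← MemLp.toLp_const_smul]
        congr 1 with ξ
        simp [smul_comm c] }
    (by
      intro x y
      rw [L2.inner_def]
      trans ∫ ξ : ℕ → ℝ, ξ k ^ 2 * inner ℝ x y ∂gaussianSeq
      · refine integral_congr_ae ?_
        filter_upwards [(memLp_eval_smul k x).coeFn_toLp, (memLp_eval_smul k y).coeFn_toLp]
          with ξ h1 h2
        simp only [LinearMap.coe_mk, AddHom.coe_mk]
        rw [h1, h2, real_inner_smul_left, real_inner_smul_right]
        ring
      · rw [integral_mul_const, integral_eval_sq_gaussianSeq, one_mul])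

lemma coeFn_gaussianIsometry (k : ℕ) (x : X) :
    gaussianIsometry X k x =ᵐ[gaussianSeq] fun ξ => ξ k • x :=
  MemLp.coeFn_toLp (memLp_eval_smul k x)

/-- Distinct coordinates are uncorrelated. Convergence of a Gaussian series in L² thus reduces to
square summability of its coefficients. -/
lemma orthogonalFamily_gaussianIsometry :
    OrthogonalFamily ℝ (fun _ : ℕ => X) (gaussianIsometry X) := by
  intro i j hij x y
  rw [L2.inner_def]
  trans ∫ ξ : ℕ → ℝ, (ξ i * ξ j) * inner ℝ x y ∂gaussianSeq
  · refine integral_congr_ae ?_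
    filter_upwards [coeFn_gaussianIsometry i x, coeFn_gaussianIsometry j y] with ξ h1 h2
    rw [h1, h2, real_inner_smul_left, real_inner_smul_right]
    ring
  · rw [integral_mul_const, integral_eval_mul_gaussianSeq hij, zero_mul]

/-- A Gaussian series with square summable coefficients converges in probability. -/
lemma exists_tendstoInMeasure_gaussianSeries {x : ℕ → X} (hx : Summable fun k => ‖x k‖ ^ 2) :
    ∃ Y : (ℕ → ℝ) → X, Measurable Y ∧ TendstoInMeasure gaussianSeq
      (fun n ξ => ∑ k ∈ Finset.range n, ξ k • x k) atTop Y := by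
  have hs := (orthogonalFamily_gaussianIsometry.summable_iff_norm_sq_summable x).2 hx
  have ht := tendstoInMeasure_of_tendsto_Lp hs.hasSum.tendsto_sum_nat
  refine ⟨_, (Lp.stronglyMeasurable _).measurable, ht.congr_left fun n => ?_⟩
  have h1 : ∀ᵐ ξ ∂gaussianSeq, ∀ k, gaussianIsometry X k (x k) ξ = ξ k • x k :=
    ae_all_iff.2 fun k => coeFn_gaussianIsometry k (x k)
  filter_upwards [h1, Lp.coeFn_finsetSum (Finset.range n) fun k => gaussianIsometry X k (x k)]
    with ξ h1 h2
  rw [h2]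
  simp [h1]

/-- Convergence of expectations along a product of an almost surely convergent and an in
probability convergent sequence. -/
lemma tendsto_integral_smul_of_tendstoInMeasure {Ω F : Type*} [MeasurableSpace Ω] {P : Measure Ω}
    [IsFiniteMeasure P] [NormedAddCommGroup F] [NormedSpace ℝ F] {T : ℕ → Ω → X} {Y : Ω → X}
    {c : ℕ → Ω → ℝ} {c₀ : ℝ} (hT : TendstoInMeasure P T atTop Y)
    (hTm : ∀ n, Measurable (T n)) (hc : ∀ᵐ ω ∂P, Tendsto (fun n => c n ω) atTop (𝓝 c₀))
    (hcm : ∀ n, Measurable (c n)) {ψ : X → F} (hψ : Continuous ψ) {M : ℝ}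
    (hM : ∀ x, ‖ψ x‖ ≤ M) :
    Tendsto (fun n => ∫ ω, ψ (c n ω • T n ω) ∂P) atTop (𝓝 (∫ ω, ψ (c₀ • Y ω) ∂P)) := by
  -- Convergence in measure gives almost sure convergence only along further subsequences, which
  -- suffices for a sequence of numbers.
  refine tendsto_of_subseq_tendsto fun ns hns => ?_
  obtain ⟨ms, hms, hae⟩ := (hT.comp hns).exists_seq_tendsto_ae
  refine ⟨ms, tendsto_integral_of_dominated_convergence (fun _ => M) (fun n => ?_)
    (integrable_const _) (fun n => ae_of_all _ fun ω => hM _) ?_⟩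
  · exact hψ.comp_aestronglyMeasurable ((hcm _).smul (hTm _)).aestronglyMeasurable
  · filter_upwards [hae, hc] with ω h1 h2
    exact (hψ.tendsto _).comp ((h2.comp (hns.comp hms.tendsto_atTop)).smul h1)

lemma integral_cexp_gaussianSeq (a : ℕ → ℝ) (n : ℕ) :
    ∫ ξ, Complex.exp ((∑ k ∈ Finset.range n, ξ k * a k : ℝ) * Complex.I) ∂gaussianSeq
      = Complex.exp (-(∑ k ∈ Finset.range n, a k ^ 2 : ℝ) / 2) := by
  have hind : iIndepFun (fun k (ξ : ℕ → ℝ) => ξ k * a k) gaussianSeq :=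
    iIndepFun_gaussianSeq.comp (fun k x => x * a k) (fun k => by fun_prop)
  have h := congrFun (iIndepFun.charFun_map_fun_finsetSum_eq_prod (s := Finset.range n)
    (fun k _ => by
      have : Measurable fun ξ : ℕ → ℝ => ξ k * a k := by fun_prop
      exact this.aemeasurable) (hind.restrict (Finset.range n))) 1
  have hm : Measurable fun ξ : ℕ → ℝ => ∑ k ∈ Finset.range n, ξ k * a k := by fun_prop
  rw [charFun_apply_real, integral_map hm.aemeasurable (by fun_prop), Finset.prod_apply] at h
  simp only [Complex.ofReal_one, one_mul] at h
  rw [h, Complex.ofReal_sum, ← Finset.sum_neg_distrib, Finset.sum_div, Complex.exp_sum]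
  refine Finset.prod_congr rfl fun k _ => ?_
  have : gaussianSeq.map (fun ξ => ξ k * a k) = gaussianReal 0 (.mk (a k ^ 2) (sq_nonneg _)) := by
    have h1 : (fun ξ : ℕ → ℝ => ξ k * a k) = (fun x => x * a k) ∘ fun ξ => ξ k := rfl
    rw [h1, ← map_map (by fun_prop) (by fun_prop), map_eval_gaussianSeq,
      gaussianReal_map_mul_const]
    simp
  rw [this, charFun_gaussianReal]
  congr 1
  simp
  ring

end Series

/-! ### Uniqueness of centered Gaussian measures and their construction by series. -/

section Gaussian

open Measure

variable {X : Type*} [NormedAddCommGroup X] [InnerProductSpace ℝ X] [CompleteSpace X]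
  [SecondCountableTopology X] [MeasurableSpace X] [BorelSpace X]

/-- The marginal at x = 0 is already prescribed to be a probability measure, and pushing forward
preserves mass. -/
lemma IsCenteredGaussian.isProbabilityMeasure {S : X →L[ℝ] X} {γ : Measure X}
    (h : IsCenteredGaussian S γ) : IsProbabilityMeasure γ := by
  have h0 := h.2 0
  have : IsProbabilityMeasure (γ.map fun η => inner ℝ (0 : X) η) := by rw [h0]; infer_instance
  exact isProbabilityMeasure_of_map (fun η => inner ℝ (0 : X) η)

/-- A centered Gaussian measure is determined by its covariance operator. -/
lemma IsCenteredGaussian.unique {S : X →L[ℝ] X} {γ γ' : Measure X}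
    (h : IsCenteredGaussian S γ) (h' : IsCenteredGaussian S γ') : γ = γ' := by
  have := h.1
  have := h'.1
  refine Measure.ext_of_charFun ?_
  have key : ∀ (ν : Measure X) (x : X), charFun ν x = charFun (ν.map fun η => inner ℝ x η) 1 := by
    intro ν x
    rw [charFun_apply, charFun_apply_real, integral_map (by fun_prop) (by fun_prop)]
    simp [real_inner_comm]
  ext x
  rw [key, key, h.2, h'.2]

lemma isCenteredGaussian_centeredGaussian {S : X →L[ℝ] X} {γ : Measure X}
    (h : IsCenteredGaussian S γ) : IsCenteredGaussian S (centeredGaussian S) := by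
  have hex : ∃ γ, IsCenteredGaussian S γ := ⟨γ, h⟩
  rw [centeredGaussian, dif_pos hex]
  exact hex.choose_spec

variable {H : Type*} [NormedAddCommGroup H] [InnerProductSpace ℝ H] [CompleteSpace H]

/-- The Gaussian series along a Hilbert basis has covariance operator `β⁻¹ ι ι*`. -/
lemma isCenteredGaussian_map_series (e : HilbertBasis ℕ ℝ H) (ι : H →L[ℝ] X) {β : ℝ} (hβ : 0 < β)
    {Y : (ℕ → ℝ) → X} (hYm : Measurable Y) (hY : TendstoInMeasure gaussianSeq
      (fun n ξ => ∑ k ∈ Finset.range n, ξ k • ι (e k)) atTop Y) :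
    IsCenteredGaussian (bathCov β ι) (gaussianSeq.map fun ξ => √β⁻¹ • Y ξ) := by
  have hm : Measurable fun ξ => √β⁻¹ • Y ξ := hYm.const_smul _
  have hprob : IsProbabilityMeasure (gaussianSeq.map fun ξ => √β⁻¹ • Y ξ) :=
    isProbabilityMeasure_map hm.aemeasurable
  refine ⟨inferInstance, fun x => ?_⟩
  refine Measure.ext_of_charFun ?_
  ext t
  rw [charFun_apply_real, integral_map (by fun_prop) (by fun_prop),
    integral_map hm.aemeasurable (by fun_prop), charFun_gaussianReal]
  have hlim := tendsto_integral_smul_of_tendstoInMeasure (c := fun _ _ => √β⁻¹) (c₀ := √β⁻¹)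
    hY (fun n => by fun_prop) (ae_of_all _ fun _ => tendsto_const_nhds) (fun _ => measurable_const)
    (ψ := fun y : X => Complex.exp ((t : ℂ) * (inner ℝ x y : ℝ) * Complex.I)) (by fun_prop) (M := 1)
    (fun y => by rw [← Complex.ofReal_mul, Complex.norm_exp_ofReal_mul_I])
  refine tendsto_nhds_unique hlim ?_
  have hn : ∀ n : ℕ, ∫ ξ : ℕ → ℝ, Complex.exp ((t : ℂ) * (inner ℝ x
      (√β⁻¹ • ∑ k ∈ Finset.range n, ξ k • ι (e k)) : ℝ) * Complex.I) ∂gaussianSeq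
      = Complex.exp (-(∑ k ∈ Finset.range n, (t * √β⁻¹ * inner ℝ x (ι (e k))) ^ 2 : ℝ) / 2) := by
    intro n
    rw [← integral_cexp_gaussianSeq]
    congr with ξ
    rw [← Complex.ofReal_mul, inner_smul_right, inner_sum, Finset.mul_sum, Finset.mul_sum]
    simp_rw [inner_smul_right]
    congr 3
    refine Finset.sum_congr rfl fun k _ => ?_
    ring
  simp_rw [hn]
  have hS : inner ℝ (bathCov β ι x) x
      = β⁻¹ * inner ℝ (ContinuousLinearMap.adjoint ι x) (ContinuousLinearMap.adjoint ι x) := by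
    rw [ContinuousLinearMap.adjoint_inner_left, real_inner_comm]
    simp [bathCov, inner_smul_right]
  -- Ensures that `toNNReal` does not truncate the variance.
  have hnn : 0 ≤ inner ℝ (bathCov β ι x) x := by
    rw [hS]
    exact mul_nonneg (inv_pos.2 hβ).le real_inner_self_nonneg
  -- Parseval in H: the squares of ⟨x, ι e_k⟩ = ⟨ι* x, e_k⟩ sum to ‖ι* x‖².
  have hpars := ((e.hasSum_inner_mul_inner (ContinuousLinearMap.adjoint ι x)
    (ContinuousLinearMap.adjoint ι x)).mul_left (t ^ 2 * β⁻¹)).tendsto_sum_nat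
  have hsum : Tendsto (fun n : ℕ => ∑ k ∈ Finset.range n, (t * √β⁻¹ * inner ℝ x (ι (e k))) ^ 2)
      atTop (𝓝 (t ^ 2 * inner ℝ (bathCov β ι x) x)) := by
    rw [hS, ← mul_assoc]
    refine hpars.congr fun n => Finset.sum_congr rfl fun k _ => ?_
    rw [ContinuousLinearMap.adjoint_inner_left, real_inner_comm (ContinuousLinearMap.adjoint ι x),
      ContinuousLinearMap.adjoint_inner_left, mul_pow, mul_pow, Real.sq_sqrt (inv_pos.2 hβ).le]
    ring
  have hcont : Continuous fun s : ℝ => Complex.exp (-(s : ℂ) / 2) := by fun_prop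
  have := (hcont.tendsto _).comp hsum
  refine (this.congr fun n => rfl).trans (le_of_eq ?_)
  simp only [Complex.ofReal_zero, mul_zero, zero_mul, zero_sub, Real.coe_toNNReal _ hnn]
  push_cast
  ring_nf

end Gaussian

/-! ### Poincaré's lemma in the larger space X. -/

section SphereLimit

open Metric Measure

/-- The uniform probability measure on the unit sphere. -/
noncomputable def sphereUniform (E : Type*) [NormedAddCommGroup E] [InnerProductSpace ℝ E]
    [FiniteDimensional ℝ E] [MeasurableSpace E] [BorelSpace E] : Measure (sphere (0 : E) 1) :=
  normalized (volume : Measure E).toSphere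

instance isProbabilityMeasure_sphereUniform (E : Type*) [NormedAddCommGroup E]
    [InnerProductSpace ℝ E] [FiniteDimensional ℝ E] [MeasurableSpace E] [BorelSpace E]
    [Nontrivial E] : IsProbabilityMeasure (sphereUniform E) := by
  refine ⟨?_⟩
  rw [sphereUniform, normalized, Measure.smul_apply, smul_eq_mul]
  exact ENNReal.inv_mul_cancel (by rw [Ne, measure_univ_eq_zero]; exact toSphere_ne_zero _)
    (measure_ne_top _ _)

lemma integral_sphereUniform {E : Type*} [NormedAddCommGroup E]
    [InnerProductSpace ℝ E] [FiniteDimensional ℝ E] [MeasurableSpace E] [BorelSpace E]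
    [Nontrivial E] {f : E → ℝ} (hf : Continuous f) :
    ∫ ω : sphere (0 : E) 1, f ω ∂(sphereUniform E) = ∫ x, f (‖x‖⁻¹ • x) ∂(stdGaussian E) := by
  have h := map_stdGaussian_direction (E := E)
  rw [← integral_map (μ := stdGaussian E) (φ := fun x => ‖x‖⁻¹ • x) (f := f) (by fun_prop)
    hf.aestronglyMeasurable, h, integral_smul_measure,
    integral_map measurable_subtype_coe.aemeasurable hf.aestronglyMeasurable, sphereUniform,
    normalized, integral_smul_measure]

variable {X : Type*} [NormedAddCommGroup X] [InnerProductSpace ℝ X] [CompleteSpace X]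
  [SecondCountableTopology X] [MeasurableSpace X] [BorelSpace X]
  {H : Type*} [NormedAddCommGroup H] [InnerProductSpace ℝ H] [MeasurableSpace H] [BorelSpace H]

/-- **Poincaré's lemma**: uniform measures on spheres of dimension `w + n` and radius asymptotic to
`ρ √(w + n)` converge to the law of a Gaussian series. -/
lemma tendsto_integral_sphereUniform (ι : H →L[ℝ] X) (e : ℕ → H) {w : ℕ} (K : ℕ → Submodule ℝ H)
    [∀ n, FiniteDimensional ℝ (K n)] (B : ∀ n, OrthonormalBasis (Fin (w + n)) ℝ (K n))
    (hB : ∀ n i, (B n i : H) = e i) {Y : (ℕ → ℝ) → X} (hY : TendstoInMeasure gaussianSeq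
      (fun n ξ => ∑ k ∈ Finset.range n, ξ k • ι (e k)) atTop Y)
    {r : ℕ → ℝ} {ρ : ℝ} (hr : Tendsto (fun n : ℕ => r n / √((w + n : ℕ) : ℝ)) atTop (𝓝 ρ))
    {ψ : X → ℝ} (hψ : Continuous ψ) {M : ℝ} (hM : ∀ x, ‖ψ x‖ ≤ M) :
    Tendsto (fun n => ∫ ω : sphere (0 : K n) 1, ψ (ι (r n • (ω : K n) : K n)) ∂(sphereUniform (K n)))
      atTop (𝓝 (∫ ξ, ψ (ρ • Y ξ) ∂gaussianSeq)) := by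
  have hshift : Tendsto (fun n : ℕ => w + n) atTop atTop :=
    tendsto_atTop_mono (fun n => Nat.le_add_left n w) tendsto_id
  -- The factor c is r_n / ‖g‖, where g is the Gaussian vector formed by the first w + n
  -- coordinates; c g is then uniform on the sphere of radius r_n.
  have hlim := tendsto_integral_smul_of_tendstoInMeasure (hY.comp hshift)
    (c := fun n ξ => r n * (√(∑ k ∈ Finset.range (w + n), ξ k ^ 2))⁻¹) (c₀ := ρ)
    (fun n => by simp only [Function.comp]; fun_prop) ?_ (fun n => by fun_prop) hψ hM
  · refine hlim.congr' ?_
    filter_upwards [eventually_ge_atTop 1] with n hn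
    have : Nontrivial (K n) := by
      refine Module.nontrivial_of_finrank_pos (R := ℝ) ?_
      rw [Module.finrank_eq_card_basis (B n).toBasis, Fintype.card_fin]
      omega
    have hcont : Continuous fun x : K n => ψ (ι (r n • x : K n)) := by fun_prop
    rw [integral_sphereUniform (f := fun x : K n => ψ (ι (r n • x : K n))) hcont]
    have hcont' : Measurable fun x : K n => ψ (ι (r n • (‖x‖⁻¹ • x) : K n)) :=
      hcont.measurable.comp (by fun_prop)
    have hsm : Measurable fun ξ : ℕ → ℝ => ∑ i : Fin (w + n), ξ i • B n i := by fun_prop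
    rw [← map_gaussianSeq_eq_stdGaussian (B n), integral_map hsm.aemeasurable
      hcont'.aestronglyMeasurable]
    refine integral_congr_ae (ae_of_all _ fun ξ => ?_)
    have hnorm : ‖∑ i : Fin (w + n), ξ i • B n i‖ = √(∑ k ∈ Finset.range (w + n), ξ k ^ 2) := by
      rw [Finset.sum_range (fun k => ξ k ^ 2), norm_eq_sqrt_real_inner,
        (B n).orthonormal.inner_sum]
      simp [pow_two]
    simp only [Function.comp]
    rw [hnorm]
    congr 1
    simp only [Submodule.coe_smul, Submodule.coe_sum, map_smul, _root_.map_sum, hB, smul_smul]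
    rw [Finset.sum_range (fun k => ξ k • ι (e k))]
  -- The law of large numbers gives ‖g‖ / √(w + n) → 1, hence c → ρ.
  · filter_upwards [tendsto_sum_sq_gaussianSeq] with ξ hξ
    have h1 := (((Real.continuous_sqrt.tendsto _).comp (hξ.comp hshift)).inv₀ (by simp))
    have h2 := hr.mul h1
    simp only [Real.sqrt_one, inv_one, mul_one, Function.comp] at h2
    refine h2.congr' ?_
    filter_upwards [eventually_ge_atTop 1] with n hn
    have hpos : 0 < √((w + n : ℕ) : ℝ) := Real.sqrt_pos.2 (by exact_mod_cast (by omega))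
    rw [Real.sqrt_mul (by positivity), Real.sqrt_inv]
    field_simp

end SphereLimit

/-! ### Pointwise limit and uniform bound of the weights. -/

section Weights

/-- A uniform bound for the microcanonical weights by the canonical one. -/
lemma sqrt_one_add_div_pow_le {m x c : ℝ} {k : ℕ} (hm : 0 < m) (hk : 0 < k)
    (hc : (k : ℝ) = 2 * (m + c)) :
    √(1 + x / m) ^ k ≤ Real.exp (c ^ 2 / m) * Real.exp x := by
  rcases le_or_gt (1 + x / m) 0 with h | h
  · rw [Real.sqrt_eq_zero_of_nonpos h, zero_pow hk.ne']
    positivity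
  · set p : ℝ := m + c with hp
    have hp0 : 0 < p := by have : (0 : ℝ) < k := by exact_mod_cast hk
                           linarith
    set t := 1 + x / m with ht
    have hx : x = m * (t - 1) := by rw [ht]; field_simp; ring
    -- With p = k/2, t^p exp(-m t) is maximal at t = p/m. Splitting off this factor and using s ≤
    -- exp(s - 1) on both parts gives t^p ≤ exp(x + (p - m)²/m), with coefficient exactly 1 on x.
    -- Bounding t by exp(x/m) directly would give the coefficient p/m.
    have h1 : t = t * m / p * (p / m) := by field_simp
    have h2 : t * m / p ≤ Real.exp (t * m / p - 1) := by
      have := Real.add_one_le_exp (t * m / p - 1); linarith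
    have h3 : p / m ≤ Real.exp (p / m - 1) := by
      have := Real.add_one_le_exp (p / m - 1); linarith
    have h4 : √t ≤ Real.exp ((t * m / p - 1 + (p / m - 1)) / 2) := by
      rw [Real.exp_half]
      refine Real.sqrt_le_sqrt ?_
      rw [Real.exp_add]
      calc t = t * m / p * (p / m) := h1
        _ ≤ _ := mul_le_mul h2 h3 (by positivity) (Real.exp_pos _).le
    refine (pow_le_pow_left₀ (Real.sqrt_nonneg _) h4 k).trans_eq ?_
    rw [← Real.exp_nat_mul, ← Real.exp_add, hc]
    congr 1
    have hc' : c = p - m := by rw [hp]; ring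
    rw [hx, hc']
    field_simp
    ring

lemma tendsto_sqrt_one_add_div_pow (x : ℝ) (w : ℕ) :
    Tendsto (fun n : ℕ => √(1 + x / ((n : ℝ) / 2)) ^ (w + n - 2)) atTop (𝓝 (Real.exp x)) := by
  have h1 : Tendsto (fun n : ℕ => 1 + x / ((n : ℝ) / 2)) atTop (𝓝 1) := by
    have := (tendsto_const_div_atTop_nhds_zero_nat (2 * x)).const_add 1
    rw [add_zero] at this
    refine this.congr fun n => ?_
    rw [div_div_eq_mul_div, mul_comm]
  have h2 : Tendsto (fun n : ℕ => (1 + x / ((n : ℝ) / 2)) ^ n) atTop (𝓝 (Real.exp (2 * x))) := by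
    refine (Real.tendsto_one_add_div_pow_exp (2 * x)).congr fun n => ?_
    rw [div_div_eq_mul_div, mul_comm]
  -- The exponent w + n - 2 is handled as √(t^n) · √t^w / t, where t → 1.
  have h3 := (((Real.continuous_sqrt.tendsto _).comp h2).mul
    (((Real.continuous_sqrt.tendsto _).comp h1).pow w)).div h1 one_ne_zero
  have hlim : √(Real.exp (2 * x)) * √1 ^ w / 1 = Real.exp x := by
    rw [Real.sqrt_one, one_pow, mul_one, div_one, ← Real.exp_half]; congr 1; ring
  rw [hlim] at h3
  refine h3.congr' ?_
  filter_upwards [h1.eventually (lt_mem_nhds one_pos), eventually_ge_atTop 2] with n hn hn2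
  simp only [Function.comp, Pi.div_apply]
  obtain ⟨m, hm⟩ : ∃ m, w + n = m + 2 := ⟨w + n - 2, by omega⟩
  rw [hm, Nat.add_sub_cancel, div_eq_iff hn.ne']
  set t := 1 + x / ((n : ℝ) / 2)
  have ht : √(t ^ n) = √t ^ n := by
    rw [Real.sqrt_eq_iff_mul_self_eq (by positivity) (by positivity), ← mul_pow,
      Real.mul_self_sqrt hn.le]
  rw [ht, ← pow_add, add_comm n w, hm, pow_add, Real.sq_sqrt hn.le]

end Weights

/-! ### Total mass and normalization of the shell measure. -/

section NormalizedShell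

open Metric Measure

variable {Z E : Type*}
  [NormedAddCommGroup Z] [InnerProductSpace ℝ Z] [FiniteDimensional ℝ Z]
  [MeasurableSpace Z] [BorelSpace Z]
  [NormedAddCommGroup E] [InnerProductSpace ℝ E] [FiniteDimensional ℝ E]
  [MeasurableSpace E] [BorelSpace E]
  {V : Z → ℝ} {b : Z → E}

lemma toSphere_real_univ_pos [Nontrivial E] :
    0 < (volume : Measure E).toSphere.real Set.univ :=
  ENNReal.toReal_pos (by rw [Ne, measure_univ_eq_zero]; exact toSphere_ne_zero _)
    (measure_ne_top _ _)

/-- The density depends on z alone, so each fibre carries the uniform law. The sphere's area comes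
out as a constant, which normalization removes. -/
lemma integral_shellMeasure_eq [Nontrivial E] (hV : Continuous V) (hb : Continuous b) {a : ℝ}
    (hI : Integrable fun z => shellDensity E a (V z)) {Φ : Z × E → ℝ} (hΦ : Continuous Φ) {M : ℝ}
    (hM : ∀ p, ‖Φ p‖ ≤ M) :
    Integrable Φ (shellMeasure V b a) ∧ ∫ p, Φ p ∂(shellMeasure V b a)
      = (volume : Measure E).toSphere.real Set.univ * ∫ z, shellDensity E a (V z) *
        ∫ ω, Φ (shellParam V b a (z, ω)) ∂(sphereUniform E) := by
  have hTc : Continuous (shellParam V b a) :=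
    (continuous_shellParam hV hb).comp (Continuous.prodMk_right a)
  have hD : Measurable fun p : Z × sphere (0 : E) 1 => shellDensity E a (V p.1) :=
    ((continuous_shellDensity_comp (E := E) hV).comp (Continuous.prodMk_right a)).measurable
  have hint : Integrable (fun p : Z × sphere (0 : E) 1 =>
      shellDensity E a (V p.1) * Φ (shellParam V b a p))
      ((volume : Measure Z).prod (volume : Measure E).toSphere) :=
    (hI.comp_fst _).mul_bdd (c := M) (hΦ.comp hTc).aestronglyMeasurable
      (ae_of_all _ fun p => hM _)
  constructor
  · rw [shellMeasure, integrable_map_measure hΦ.aestronglyMeasurable hTc.measurable.aemeasurable,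
      integrable_withDensity_iff_integrable_smul' hD.ennreal_ofReal (by simp)]
    simpa [ENNReal.toReal_ofReal, shellDensity_nonneg] using hint
  · rw [integral_shellMeasure hV hb a hΦ, integral_prod _ hint, ← integral_const_mul]
    refine integral_congr_ae (ae_of_all _ fun z => ?_)
    simp only
    rw [integral_const_mul, sphereUniform, normalized, integral_smul_measure, smul_eq_mul,
      ENNReal.toReal_inv, ← measureReal_def, mul_left_comm, mul_inv_cancel_left₀]
    exact toSphere_real_univ_pos.ne'

/-- If the marginal density is integrable and nontrivial, the normalized surface measure is a
probability measure. -/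
lemma isProbabilityMeasure_normalized_shellMeasure [Nontrivial E] (hV : Continuous V)
    (hb : Continuous b) {a : ℝ} (hI : Integrable fun z => shellDensity E a (V z))
    (hpos : 0 < ∫ z, shellDensity E a (V z)) :
    IsProbabilityMeasure (normalized (shellMeasure V b a)) ∧
    ∀ Φ : Z × E → ℝ, Continuous Φ → (∃ M, ∀ p, ‖Φ p‖ ≤ M) →
      ∫ p, Φ p ∂(normalized (shellMeasure V b a)) = (∫ z, shellDensity E a (V z))⁻¹ *
        ∫ z, shellDensity E a (V z) * ∫ ω, Φ (shellParam V b a (z, ω)) ∂(sphereUniform E) := by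
  have hσ : 0 < (volume : Measure E).toSphere.real Set.univ :=
    toSphere_real_univ_pos
  obtain ⟨h1, h2⟩ := integral_shellMeasure_eq hV hb hI (Φ := fun _ => 1) continuous_const
    (M := 1) (by simp)
  simp only [integral_const, smul_eq_mul, mul_one, probReal_univ] at h2
  have hfin : IsFiniteMeasure (shellMeasure V b a) := by
    -- A nonzero constant is integrable only for a finite measure.
    rcases integrable_const_iff.1 h1 with h | h
    · simp at h
    · exact h
  have hne : shellMeasure V b a Set.univ ≠ 0 := by
    intro h
    rw [measureReal_def, h, ENNReal.toReal_zero] at h2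
    exact (mul_pos hσ hpos).ne h2
  refine ⟨⟨?_⟩, fun Φ hΦ ⟨M, hM⟩ => ?_⟩
  · rw [normalized, Measure.smul_apply, smul_eq_mul]
    exact ENNReal.inv_mul_cancel hne (measure_ne_top _ _)
  · rw [normalized, integral_smul_measure, (integral_shellMeasure_eq hV hb hI hΦ hM).2,
      ENNReal.toReal_inv, ← measureReal_def, h2, smul_eq_mul, mul_inv, mul_assoc,
      mul_left_comm, inv_mul_cancel_left₀ hσ.ne']

end NormalizedShell

/-! ### A Hilbert basis adapted to the filtration of heat-bath subspaces. -/

section AdaptedBasis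

variable {H : Type*} [NormedAddCommGroup H] [InnerProductSpace ℝ H] [CompleteSpace H]

/-- A Hilbert basis of `H` whose initial segments are orthonormal bases of `W ⊔ Ξ n`. -/
lemma exists_adapted_hilbertBasis (W : Submodule ℝ H) [FiniteDimensional ℝ W]
    (Ξ : ℕ → Submodule ℝ H) [∀ n, FiniteDimensional ℝ (Ξ n)] (hΞ_mono : Monotone Ξ)
    (hΞ_dim : ∀ n, Module.finrank ℝ (Ξ n) = n) (hΞ_closure : (⨆ n, Ξ n).topologicalClosure = Wᗮ) :
    ∃ (e : HilbertBasis ℕ ℝ H)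
      (B : ∀ n, OrthonormalBasis (Fin (Module.finrank ℝ W + n)) ℝ (W ⊔ Ξ n : Submodule ℝ H)),
      ∀ n i, (B n i : H) = e i := by
  set w := Module.finrank ℝ W with hw
  have hΞW : ∀ n, Ξ n ≤ Wᗮ := fun n =>
    (le_iSup Ξ n).trans ((Submodule.le_topologicalClosure _).trans hΞ_closure.le)
  have hex : ∀ n, ∃ u ∈ Ξ (n + 1), u ∈ (Ξ n)ᗮ ∧ ‖u‖ = 1 := by
    intro n
    -- The complement of Ξ n in Ξ (n + 1) has dimension 1; the new basis vector is a unit vector in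
    -- it.
    have h := Submodule.finrank_add_inf_finrank_orthogonal (hΞ_mono (Nat.le_add_right n 1))
    rw [hΞ_dim, hΞ_dim] at h
    have : Nontrivial ((Ξ n)ᗮ ⊓ Ξ (n + 1) : Submodule ℝ H) :=
      Module.nontrivial_of_finrank_pos (R := ℝ) (by omega)
    obtain ⟨⟨x, hx1, hx2⟩, hx0⟩ := exists_ne (0 : ((Ξ n)ᗮ ⊓ Ξ (n + 1) : Submodule ℝ H))
    have hx0 : x ≠ 0 := fun h => hx0 (by ext; exact h)
    exact ⟨‖x‖⁻¹ • x, Submodule.smul_mem _ _ hx2, Submodule.smul_mem _ _ hx1,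
      norm_smul_inv_norm (𝕜 := ℝ) hx0⟩
  choose u hu1 hu2 hu3 using hex
  set bW := stdOrthonormalBasis ℝ W
  set e : ℕ → H := fun k => if h : k < w then (bW ⟨k, h⟩ : H) else u (k - w) with he
  have heW : ∀ k (h : k < w), e k = bW ⟨k, h⟩ := fun k h => by simp [he, h]
  have heU : ∀ k, w ≤ k → e k = u (k - w) := fun k h => by simp [he, not_lt.2 h]
  have huu : ∀ i j, i < j → inner ℝ (u i) (u j) = 0 := fun i j hij =>
    Submodule.inner_right_of_mem_orthogonal (hΞ_mono hij (hu1 i)) (hu2 j)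
  have horth : ∀ i j, i < j → inner ℝ (e i) (e j) = 0 := by
    intro i j hij
    rcases lt_or_ge j w with hj | hj
    · rw [heW i (hij.trans hj), heW j hj, ← Submodule.coe_inner]
      exact bW.orthonormal.2 (by simp [hij.ne])
    · rw [heU j hj]
      rcases lt_or_ge i w with hi | hi
      · rw [heW i hi]
        exact Submodule.inner_right_of_mem_orthogonal (bW ⟨i, hi⟩).2 (hΞW _ (hu1 _))
      · rw [heU i hi]
        exact huu _ _ (by omega)
  have hon : Orthonormal ℝ e := by
    constructor
    · intro k
      rcases lt_or_ge k w with hk | hk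
      · rw [heW k hk, Submodule.norm_coe]; exact bW.orthonormal.1 _
      · rw [heU k hk]; exact hu3 _
    · intro i j hij
      rcases lt_or_gt_of_ne hij with h | h
      · exact horth i j h
      · rw [real_inner_comm]; exact horth j i h
  have hmem : ∀ n k, k < w + n → e k ∈ W ⊔ Ξ n := by
    intro n k hk
    rcases lt_or_ge k w with h | h
    · rw [heW k h]; exact Submodule.mem_sup_left (bW ⟨k, h⟩).2
    · rw [heU k h]; exact Submodule.mem_sup_right (hΞ_mono (by omega) (hu1 _))
  have hdim : ∀ n, Module.finrank ℝ (W ⊔ Ξ n : Submodule ℝ H) = w + n := by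
    intro n
    have h := Submodule.finrank_sup_add_finrank_inf_eq W (Ξ n)
    have hbot : W ⊓ Ξ n = ⊥ :=
      (W.orthogonal_disjoint.mono_right (hΞW n)).eq_bot
    rwa [hbot, finrank_bot, add_zero, hΞ_dim] at h
  have hB : ∀ n, ∃ B : OrthonormalBasis (Fin (w + n)) ℝ (W ⊔ Ξ n : Submodule ℝ H),
      ∀ i, (B i : H) = e i := by
    intro n
    obtain ⟨B, hB⟩ := Orthonormal.exists_orthonormalBasis_extension_of_card_eq
      (𝕜 := ℝ) (E := (W ⊔ Ξ n : Submodule ℝ H)) (ι := Fin (w + n)) (by simp [hdim])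
      (v := fun i => ⟨e i, hmem n i i.2⟩) (s := Set.univ) (by
        constructor
        · intro i; exact hon.1 _
        · intro i j hij
          refine hon.2 fun h => hij ?_
          exact Subtype.ext (Fin.ext h))
    exact ⟨B, fun i => by rw [hB i (Set.mem_univ _)]⟩
  choose B hB using hB
  -- A vector orthogonal to every e_k is orthogonal to W, hence lies in the closure of the union of
  -- the Ξ n; being orthogonal to that union too, it is 0.
  have hspan : (Submodule.span ℝ (Set.range e))ᗮ = ⊥ := by
    rw [Submodule.eq_bot_iff]
    intro x hx
    have hxe : ∀ k, inner ℝ (e k) x = 0 := fun k =>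
      hx _ (Submodule.subset_span ⟨k, rfl⟩)
    have hxn : ∀ n, x ∈ (W ⊔ Ξ n)ᗮ := by
      intro n y hy
      have := (B n).sum_repr ⟨y, hy⟩
      have hy' : y = ∑ i, (B n).repr ⟨y, hy⟩ i • e i := by
        have h := congrArg Subtype.val this
        simp only [Submodule.coe_sum, Submodule.coe_smul, hB] at h
        exact h.symm
      rw [hy', sum_inner]
      exact Finset.sum_eq_zero fun i _ => by rw [real_inner_smul_left, hxe, mul_zero]
    have hxW : x ∈ (⨆ n, Ξ n).topologicalClosure := by
      rw [hΞ_closure]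
      exact Submodule.orthogonal_le le_sup_left (hxn 0)
    have hxΞ : x ∈ (⨆ n, Ξ n)ᗮ := by
      rw [← Submodule.iInf_orthogonal, Submodule.mem_iInf]
      exact fun n => Submodule.orthogonal_le le_sup_right (hxn n)
    rw [← Submodule.orthogonal_closure] at hxΞ
    exact inner_self_eq_zero.1 (Submodule.inner_right_of_mem_orthogonal hxW hxΞ)
  refine ⟨HilbertBasis.mkOfOrthogonalEqBot hon hspan, B, fun n i => ?_⟩
  rw [hB, HilbertBasis.coe_mkOfOrthogonalEqBot]

end AdaptedBasis

/-! ### Convergence of the Z-marginals. -/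

section MarginalWeights

variable {Z : Type*} [NormedAddCommGroup Z] [InnerProductSpace ℝ Z] [FiniteDimensional ℝ Z]
  [MeasurableSpace Z] [BorelSpace Z]

/-- Isolates the factor √(n/β), which does not depend on z and cancels on normalization. -/
lemma shellRadius_eq {β : ℝ} (hβ : 0 < β) {n : ℕ} (hn : 1 ≤ n) (E₀ v : ℝ) :
    shellRadius ((n : ℝ) / (2 * β) + E₀) v
      = √((n : ℝ) / β) * √(1 + β * (E₀ - v) / ((n : ℝ) / 2)) := by
  have hn0 : (0 : ℝ) < n := by exact_mod_cast hn
  rw [shellRadius, ← Real.sqrt_mul (by positivity)]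
  congr 1
  field_simp
  ring

/-- The squared radius is n/β + 2(E₀ - v), so the potential enters only at lower order and all
fibres share the limiting variance 1/β. -/
lemma tendsto_shellRadius_div_sqrt (β E₀ v : ℝ) (w : ℕ) :
    Tendsto (fun n : ℕ => shellRadius ((n : ℝ) / (2 * β) + E₀) v / √((w + n : ℕ) : ℝ)) atTop
      (𝓝 (√β⁻¹)) := by
  have h1 : Tendsto (fun n : ℕ => (n : ℝ) / ((n : ℝ) + w)) atTop (𝓝 1) :=
    tendsto_natCast_div_add_atTop (w : ℝ)
  have h2 : Tendsto (fun n : ℕ => (2 * (E₀ - v)) / ((n : ℝ) + w)) atTop (𝓝 0) :=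
    (tendsto_natCast_atTop_atTop.atTop_add tendsto_const_nhds).const_div_atTop _
  have h3 := (h1.mul_const β⁻¹).add h2
  rw [one_mul, add_zero] at h3
  refine ((Real.continuous_sqrt.tendsto _).comp h3).congr fun n => ?_
  rw [shellRadius, ← Real.sqrt_div' _ (Nat.cast_nonneg _)]
  simp only [Function.comp]
  congr 1
  push_cast
  rw [add_comm (w : ℝ)]
  -- For β = 0 both sides agree because division by zero gives 0.
  rcases eq_or_ne β 0 with rfl | hβ
  · simp
  · field_simp
    ring

/-- The unnormalized density of the `Z`-marginal of the microcanonical measure. -/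
noncomputable def marginalWeight (β E₀ : ℝ) (V : Z → ℝ) (w n : ℕ) (z : Z) : ℝ :=
  √(1 + β * (E₀ - V z) / ((n : ℝ) / 2)) ^ (w + n - 2)

variable {V : Z → ℝ} {β E₀ : ℝ}

lemma shellDensity_eq {E : Type*} [NormedAddCommGroup E] [InnerProductSpace ℝ E] (hβ : 0 < β)
    {w n : ℕ} (hE : Module.finrank ℝ E = w + n) (hn : 1 ≤ n) (z : Z) :
    shellDensity E ((n : ℝ) / (2 * β) + E₀) (V z)
      = √((n : ℝ) / β) ^ (w + n - 2) * marginalWeight β E₀ V w n z := by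
  rw [shellDensity, shellRadius_eq hβ hn, mul_pow, hE, marginalWeight]

lemma marginalWeight_nonneg (w n : ℕ) (z : Z) : 0 ≤ marginalWeight β E₀ V w n z :=
  pow_nonneg (Real.sqrt_nonneg _) _

/-- The general bound with m = n/2 and c = w/2 - 1; since m ≥ 1, c²/m ≤ c², which makes the constant
independent of n. -/
lemma marginalWeight_le {w n : ℕ} (hn : 3 ≤ n) (z : Z) :
    marginalWeight β E₀ V w n z
      ≤ Real.exp (((w : ℝ) / 2 - 1) ^ 2) * Real.exp (β * (E₀ - V z)) := by
  have hn' : (3 : ℝ) ≤ n := by exact_mod_cast hn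
  refine (sqrt_one_add_div_pow_le (c := (w : ℝ) / 2 - 1) (by linarith) (by omega) ?_).trans ?_
  · rw [Nat.cast_sub (by omega)]; push_cast; ring
  · refine mul_le_mul_of_nonneg_right (Real.exp_le_exp.2 ?_) (Real.exp_pos _).le
    exact div_le_self (sq_nonneg _) (by linarith)

lemma continuous_marginalWeight (hV : Continuous V) (w n : ℕ) :
    Continuous (marginalWeight β E₀ V w n) := by
  unfold marginalWeight; fun_prop

lemma integrable_marginalWeight (hV : Continuous V)
    (hint : Integrable fun z => Real.exp (β * (E₀ - V z))) {w n : ℕ} (hn : 3 ≤ n) :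
    Integrable (marginalWeight β E₀ V w n) := by
  refine (hint.const_mul (Real.exp (((w : ℝ) / 2 - 1) ^ 2))).mono'
    (continuous_marginalWeight hV w n).aestronglyMeasurable (ae_of_all _ fun z => ?_)
  rw [Real.norm_of_nonneg (marginalWeight_nonneg _ _ _)]
  exact marginalWeight_le hn z

/-- Dominated convergence, used with A = 1 for the normalization and with the fibre averages for the
numerator. -/
lemma tendsto_integral_marginalWeight_mul (hV : Continuous V)
    (hint : Integrable fun z => Real.exp (β * (E₀ - V z))) (w : ℕ) {A : ℕ → Z → ℝ} {A₀ : Z → ℝ}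
    {M : ℝ} (hAm : ∀ᶠ n in atTop, AEStronglyMeasurable (A n)) (hM : ∀ᶠ n in atTop, ∀ z, ‖A n z‖ ≤ M)
    (hA : ∀ z, Tendsto (fun n => A n z) atTop (𝓝 (A₀ z))) :
    Tendsto (fun n => ∫ z, marginalWeight β E₀ V w n z * A n z) atTop
      (𝓝 (∫ z, Real.exp (β * (E₀ - V z)) * A₀ z)) := by
  refine tendsto_integral_filter_of_dominated_convergence
    (fun z => Real.exp (((w : ℝ) / 2 - 1) ^ 2) * Real.exp (β * (E₀ - V z)) * M) ?_ ?_
    ((hint.const_mul _).mul_const _) (ae_of_all _ fun z => ?_)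
  · filter_upwards [hAm] with n hn
    exact (continuous_marginalWeight hV w n).aestronglyMeasurable.mul hn
  · filter_upwards [hM, eventually_ge_atTop 3] with n hn hn3
    refine ae_of_all _ fun z => ?_
    rw [norm_mul, Real.norm_of_nonneg (marginalWeight_nonneg _ _ _)]
    exact mul_le_mul (marginalWeight_le hn3 z) (hn z) (norm_nonneg _) (by positivity)
  · exact (tendsto_sqrt_one_add_div_pow _ w).mul (hA z)

end MarginalWeights

/-! ### Integrals against the canonical measure. -/

section Canonical

variable {Z H X : Type*}
  [NormedAddCommGroup Z] [InnerProductSpace ℝ Z] [FiniteDimensional ℝ Z]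
  [MeasurableSpace Z] [BorelSpace Z]
  [NormedAddCommGroup H] [InnerProductSpace ℝ H] [CompleteSpace H]
  [MeasurableSpace H] [BorelSpace H]
  [NormedAddCommGroup X] [InnerProductSpace ℝ X] [CompleteSpace X]
  [SecondCountableTopology X] [MeasurableSpace X] [BorelSpace X]
  {β : ℝ} {HA : Z → ℝ} {C : Z →L[ℝ] H} {ι : H →L[ℝ] X}

lemma isProbabilityMeasure_muZ (hHA : Continuous HA)
    (hint : Integrable (fun z => Real.exp (-β * (HA z - ‖C z‖ ^ 2 / 2)))) :
    IsProbabilityMeasure (muZ β HA C) ∧ ∀ f : Z → ℝ, ∫ z, f z ∂(muZ β HA C)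
      = (∫ z, Real.exp (-β * (HA z - ‖C z‖ ^ 2 / 2)))⁻¹ *
        ∫ z, Real.exp (-β * (HA z - ‖C z‖ ^ 2 / 2)) * f z := by
  have hpos := integral_exp_pos hint
  have hmass : ((volume : Measure Z).withDensity
      fun z => ENNReal.ofReal (Real.exp (-β * (HA z - ‖C z‖ ^ 2 / 2)))) Set.univ
      = ENNReal.ofReal (∫ z, Real.exp (-β * (HA z - ‖C z‖ ^ 2 / 2))) := by
    rw [withDensity_apply _ MeasurableSet.univ, Measure.restrict_univ,
      ofReal_integral_eq_lintegral_ofReal hint (ae_of_all _ fun z => (Real.exp_pos _).le)]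
  refine ⟨⟨?_⟩, fun f => ?_⟩
  · rw [muZ, normalized, Measure.smul_apply, smul_eq_mul, hmass]
    exact ENNReal.inv_mul_cancel (by simpa using hpos) ENNReal.ofReal_ne_top
  · rw [muZ, normalized, integral_smul_measure, hmass, ENNReal.toReal_inv,
      ENNReal.toReal_ofReal hpos.le, integral_withDensity_eq_integral_toReal_smul
      (by fun_prop) (by simp)]
    simp [ENNReal.toReal_ofReal, Real.exp_nonneg]

lemma isMarkovKernel_gaussianKernel {S : X →L[ℝ] X} (hS : IsCenteredGaussian S (centeredGaussian S))
    {m : Z → X} (hm : Measurable m) : IsMarkovKernel (gaussianKernel m hm S) := by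
  have := hS.isProbabilityMeasure
  exact ⟨fun z => Measure.isProbabilityMeasure_map (by fun_prop)⟩

lemma integral_canonical (hHA : Continuous HA)
    (hint : Integrable (fun z => Real.exp (-β * (HA z - ‖C z‖ ^ 2 / 2))))
    (hS : IsCenteredGaussian (bathCov β ι) (centeredGaussian (bathCov β ι))) :
    IsProbabilityMeasure (canonical β HA C ι) ∧
    ∀ φ : BoundedContinuousFunction (Z × X) ℝ, ∫ p, φ p ∂(canonical β HA C ι)
      = (∫ z, Real.exp (-β * (HA z - ‖C z‖ ^ 2 / 2)))⁻¹ *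
        ∫ z, Real.exp (-β * (HA z - ‖C z‖ ^ 2 / 2)) *
          ∫ y, φ (z, -ι (C z) + y) ∂(centeredGaussian (bathCov β ι)) := by
  obtain ⟨hprob, hmu⟩ := isProbabilityMeasure_muZ hHA hint
  have hker : IsMarkovKernel (gaussianKernel (fun z => -ι (C z))
      ((ι.continuous.comp C.continuous).neg.measurable) (bathCov β ι)) :=
    isMarkovKernel_gaussianKernel hS _
  refine ⟨by unfold canonical; infer_instance, fun φ => ?_⟩
  unfold canonical
  rw [Measure.integral_compProd (φ.integrable _), hmu]
  congr 2 with z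
  congr 1
  change ∫ y, φ (z, y) ∂(gaussian (-ι (C z)) (bathCov β ι)) = _
  have hφ : Continuous fun y => φ (z, y) := by fun_prop
  rw [gaussian, integral_map (by fun_prop) hφ.aestronglyMeasurable]

end Canonical

/-! ### Microcanonical measures as normalized shell measures. -/

section Microcanonical

open Metric

variable {Z H X : Type*}
  [NormedAddCommGroup Z] [InnerProductSpace ℝ Z] [FiniteDimensional ℝ Z]
  [MeasurableSpace Z] [BorelSpace Z]
  [NormedAddCommGroup H] [InnerProductSpace ℝ H]
  [MeasurableSpace H] [BorelSpace H]
  [NormedAddCommGroup X] [InnerProductSpace ℝ X]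
  [SecondCountableTopology X] [MeasurableSpace X] [BorelSpace X]

/-- The effective potential `H_A(z) - ‖C z‖² / 2`. -/
noncomputable def effectivePotential (HA : Z → ℝ) (C : Z →L[ℝ] H) (z : Z) : ℝ :=
  HA z - ‖C z‖ ^ 2 / 2

/-- The center `-C z` of the energy spheres, as an element of `K`. -/
def bathCenter (C : Z →L[ℝ] H) {K : Submodule ℝ H} (hC : ∀ z, C z ∈ K) (z : Z) : K :=
  ⟨-C z, K.neg_mem (hC z)⟩

lemma continuous_bathCenter (C : Z →L[ℝ] H) {K : Submodule ℝ H} (hC : ∀ z, C z ∈ K) :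
    Continuous (bathCenter C hC) :=
  C.continuous.neg.subtype_mk _

/-- Completing the square. The range condition on C keeps the centre -Cz inside K, so that the
fibres are full spheres of K about it. -/
lemma HtotalOn_eq_shiftedEnergy (HA : Z → ℝ) (C : Z →L[ℝ] H) {K : Submodule ℝ H}
    (hC : ∀ z, C z ∈ K) :
    HtotalOn HA C K = shiftedEnergy (effectivePotential HA C) (bathCenter C hC) := by
  ext ⟨z, η⟩
  have h : ‖η - bathCenter C hC z‖ = ‖C z + (η : H)‖ := by
    rw [← Submodule.norm_coe, Submodule.coe_sub, bathCenter, sub_neg_eq_add, add_comm]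
  simp only [HtotalOn, Htotal, shiftedEnergy, effectivePotential, h, norm_add_sq_real]
  ring

variable {HA : Z → ℝ} {C : Z →L[ℝ] H} {ι : H →L[ℝ] X} {K : Submodule ℝ H} [FiniteDimensional ℝ K]

/-- Uniqueness identifies the measure picked by choice in `pdelta` with the explicit shell measure.
-/
lemma pdelta_HtotalOn (hHA : Continuous HA) (hC : ∀ z, C z ∈ K) (hK : 3 ≤ Module.finrank ℝ K) :
    (∀ a, IsPDelta (HtotalOn HA C K) a (pdelta (HtotalOn HA C K) a)) ∧
    ∀ a, pdelta (HtotalOn HA C K) a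
      = shellMeasure (effectivePotential HA C) (bathCenter C hC) a := by
  have hV : Continuous (effectivePotential HA C) := by unfold effectivePotential; fun_prop
  have h := isPDelta_shellMeasure hV (continuous_bathCenter C hC) hK
  rw [← HtotalOn_eq_shiftedEnergy] at h
  exact ⟨fun a => isPDelta_pdelta (h a), fun a => (isPDelta_pdelta (h a)).unique (h a)⟩

variable {β E₀ : ℝ}

/-- The average of `φ` over the fibre of the microcanonical measure above `z`. -/
noncomputable def fibreAverage (C : Z →L[ℝ] H) (ι : H →L[ℝ] X) (K : Submodule ℝ H)
    [FiniteDimensional ℝ K] (r : Z → ℝ) (φ : Z × X → ℝ) (z : Z) : ℝ :=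
  ∫ ω : sphere (0 : K) 1, φ (z, -ι (C z) + ι (r z • (ω : K) : K)) ∂(sphereUniform K)

/-- The sphere's area and the power of √(n/β) both cancel in the quotient, leaving only quantities
that have limits. -/
lemma integral_microcanonicalX (hβ : 0 < β) (hHA : Continuous HA) (hC : ∀ z, C z ∈ K) {w n : ℕ}
    (hn : 3 ≤ n) (hK : Module.finrank ℝ K = w + n)
    (hint : Integrable fun z => Real.exp (β * (E₀ - effectivePotential HA C z)))
    (hpos : 0 < ∫ z, marginalWeight β E₀ (effectivePotential HA C) w n z) :
    IsProbabilityMeasure (microcanonicalX HA C ι K ((n : ℝ) / (2 * β) + E₀)) ∧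
    ∀ φ : BoundedContinuousFunction (Z × X) ℝ,
      ∫ p, φ p ∂(microcanonicalX HA C ι K ((n : ℝ) / (2 * β) + E₀))
      = (∫ z, marginalWeight β E₀ (effectivePotential HA C) w n z)⁻¹ *
        ∫ z, marginalWeight β E₀ (effectivePotential HA C) w n z *
          fibreAverage C ι K (fun z => shellRadius ((n : ℝ) / (2 * β) + E₀)
            (effectivePotential HA C z)) φ z := by
  have hV : Continuous (effectivePotential HA C) := by unfold effectivePotential; fun_prop
  have hnt : Nontrivial K := Module.nontrivial_of_finrank_pos (R := ℝ) (by omega)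
  have hden : (fun z => shellDensity K ((n : ℝ) / (2 * β) + E₀) (effectivePotential HA C z))
      = fun z => √((n : ℝ) / β) ^ (w + n - 2) *
        marginalWeight β E₀ (effectivePotential HA C) w n z :=
    funext fun z => shellDensity_eq hβ hK (by omega) z
  have hs : 0 < √((n : ℝ) / β) ^ (w + n - 2) :=
    pow_pos (Real.sqrt_pos.2 (div_pos (by exact_mod_cast (by omega)) hβ)) _
  obtain ⟨hprob, hform⟩ := isProbabilityMeasure_normalized_shellMeasure hV
    (continuous_bathCenter C hC) (a := (n : ℝ) / (2 * β) + E₀)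
    (by rw [hden]; exact (integrable_marginalWeight hV hint hn).const_mul _)
    (by rw [hden, integral_const_mul]; exact mul_pos hs hpos)
  have hm : Continuous fun p : Z × K => (p.1, ι (p.2 : H)) := by fun_prop
  rw [microcanonicalX, microcanonical, (pdelta_HtotalOn hHA hC (by omega)).2]
  refine ⟨Measure.isProbabilityMeasure_map hm.measurable.aemeasurable, fun φ => ?_⟩
  rw [integral_map hm.measurable.aemeasurable φ.continuous.aestronglyMeasurable,
    hform (fun p => φ (p.1, ι (p.2 : H))) (φ.continuous.comp hm)
      ⟨‖φ‖, fun p => φ.norm_coe_le_norm _⟩]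
  simp_rw [congrFun hden, mul_assoc, integral_const_mul]
  rw [mul_inv, mul_assoc, mul_left_comm, inv_mul_cancel_left₀ hs.ne']
  congr 2 with z
  congr 1
  refine integral_congr_ae (ae_of_all _ fun ω => ?_)
  simp only [shellParam, Submodule.coe_add, map_add, bathCenter, map_neg]
  rw [add_comm]

lemma aestronglyMeasurable_fibreAverage (hnt : Nontrivial K) {r : Z → ℝ} (hr : Continuous r)
    {φ : Z × X → ℝ} (hφ : Continuous φ) :
    AEStronglyMeasurable (fibreAverage C ι K r φ) := by
  have hc : Continuous fun p : Z × sphere (0 : K) 1 =>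
      φ (p.1, -ι (C p.1) + ι (r p.1 • (p.2 : K) : K)) := by fun_prop
  exact (hc.stronglyMeasurable.integral_prod_right' (ν := sphereUniform K)).aestronglyMeasurable

lemma norm_fibreAverage_le (hnt : Nontrivial K) (r : Z → ℝ) {φ : Z × X → ℝ} {M : ℝ}
    (hM : ∀ p, ‖φ p‖ ≤ M) (z : Z) : ‖fibreAverage C ι K r φ z‖ ≤ M := by
  have := norm_integral_le_of_norm_le_const (μ := sphereUniform K)
    (ae_of_all _ fun ω : sphere (0 : K) 1 => hM (z, -ι (C z) + ι (r z • (ω : K) : K)))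
  rwa [probReal_univ, mul_one] at this

end Microcanonical

end HeatBath

/-! ### Assembly of the main theorem. -/

theorem lemmal
    {Z H X : Type*}
    -- System A: a finite-dimensional real Hilbert space
    [NormedAddCommGroup Z] [InnerProductSpace ℝ Z] [FiniteDimensional ℝ Z]
    [MeasurableSpace Z] [BorelSpace Z]
    -- the heat bath `H` and the larger separable Hilbert space `X`
    [NormedAddCommGroup H] [InnerProductSpace ℝ H] [CompleteSpace H]
    [MeasurableSpace H] [BorelSpace H]
    [NormedAddCommGroup X] [InnerProductSpace ℝ X] [CompleteSpace X]
    [SecondCountableTopology X] [MeasurableSpace X] [BorelSpace X]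
    -- the dense Hilbert-Schmidt embedding of `H` into `X`
    (ι : H →L[ℝ] X) (hι_inj : Function.Injective ι) (hι_dense : DenseRange ι)
    (hι_HS : HeatBath.IsHilbertSchmidt ι)
    -- the observable subspace `W` and the coupling operator `C`, with range in `W`
    (W : Submodule ℝ H) [FiniteDimensional ℝ W]
    (C : Z →L[ℝ] H) (hC : ∀ z, C z ∈ W)
    -- the subspaces `Ξ n`, increasing, `n`-dimensional, with union dense in `Wᗮ`
    (Ξ : ℕ → Submodule ℝ H) [∀ n, FiniteDimensional ℝ (Ξ n)]
    (hΞ_mono : Monotone Ξ) (hΞ_dim : ∀ n, Module.finrank ℝ (Ξ n) = n)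
    (hΞ_closure : (⨆ n, Ξ n).topologicalClosure = Wᗮ)
    -- inverse temperature, Hamiltonian of System A, and energy level
    (β : ℝ) (hβ : 0 < β)
    (HA : Z → ℝ) (hHA : ContDiff ℝ 2 HA) (hHA_lip : ∃ L, LipschitzWith L (fderiv ℝ HA))
    (hHA_int : Integrable (fun z => Real.exp (-β * (HA z - ‖C z‖ ^ 2 / 2))))
    (E₀ : ℝ) :
    -- the Gaussian measure and the canonical measure are well defined
    HeatBath.IsCenteredGaussian (HeatBath.bathCov β ι)
        (HeatBath.centeredGaussian (HeatBath.bathCov β ι)) ∧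
    IsProbabilityMeasure (HeatBath.canonical β HA C ι) ∧
    -- the microcanonical measures are well defined for all large `n`
    (∀ᶠ n : ℕ in atTop,
      (∀ a : ℝ, HeatBath.IsPDelta (HeatBath.HtotalOn HA C (W ⊔ Ξ n)) a
        (HeatBath.pdelta (HeatBath.HtotalOn HA C (W ⊔ Ξ n)) a)) ∧
      HeatBath.IsDisintegration (HeatBath.HtotalOn HA C (W ⊔ Ξ n))
        (fun a => HeatBath.pdelta (HeatBath.HtotalOn HA C (W ⊔ Ξ n)) a) ∧
      IsProbabilityMeasure
        (HeatBath.microcanonicalX HA C ι (W ⊔ Ξ n) ((n : ℝ) / (2 * β) + E₀))) ∧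
    -- weak convergence on `Z × X`
    ∀ φ : BoundedContinuousFunction (Z × X) ℝ,
      Tendsto
        (fun n : ℕ => ∫ p, φ p ∂(HeatBath.microcanonicalX HA C ι (W ⊔ Ξ n)
          ((n : ℝ) / (2 * β) + E₀)))
        atTop (𝓝 (∫ p, φ p ∂(HeatBath.canonical β HA C ι))) := by
  open HeatBath in
  obtain ⟨e, B, hB⟩ := exists_adapted_hilbertBasis W Ξ hΞ_mono hΞ_dim hΞ_closure
  have hdim : ∀ n, Module.finrank ℝ (W ⊔ Ξ n : Submodule ℝ H) = Module.finrank ℝ W + n := fun n => by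
    rw [Module.finrank_eq_card_basis (B n).toBasis, Fintype.card_fin]
  have hCn : ∀ n z, C z ∈ W ⊔ Ξ n := fun n z => Submodule.mem_sup_left (hC z)
  have hnt : ∀ n, 1 ≤ n → Nontrivial (W ⊔ Ξ n : Submodule ℝ H) := fun n hn =>
    Module.nontrivial_of_finrank_pos (R := ℝ) (by rw [hdim]; omega)
  obtain ⟨Y, hYm, hY⟩ := exists_tendstoInMeasure_gaussianSeries (hι_HS e e.orthonormal)
  have hγ := isCenteredGaussian_map_series e ι hβ hYm hY
  have hG := isCenteredGaussian_centeredGaussian hγ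
  have hGeq := hG.unique hγ
  have hHAc := hHA.continuous
  obtain ⟨hcan, hcanint⟩ := integral_canonical hHAc hHA_int hG
  have hV : Continuous (effectivePotential HA C) := by unfold effectivePotential; fun_prop
  -- The energy offset E₀ contributes only the factor exp(β E₀), which cancels between numerator and
  -- normalization at the end.
  have hexp : ∀ z, Real.exp (β * (E₀ - effectivePotential HA C z))
      = Real.exp (β * E₀) * Real.exp (-β * (HA z - ‖C z‖ ^ 2 / 2)) := fun z => by
    rw [← Real.exp_add, effectivePotential]; congr 1; ring
  have hint : Integrable fun z => Real.exp (β * (E₀ - effectivePotential HA C z)) := by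
    simp_rw [hexp]; exact hHA_int.const_mul _
  have hmass : Tendsto (fun n => ∫ z,
      marginalWeight β E₀ (effectivePotential HA C) (Module.finrank ℝ W) n z) atTop
      (𝓝 (∫ z, Real.exp (β * (E₀ - effectivePotential HA C z)))) := by
    have := tendsto_integral_marginalWeight_mul hV hint (Module.finrank ℝ W)
      (A := fun _ _ => 1) (A₀ := fun _ => 1)
      (M := 1) (Eventually.of_forall fun _ => aestronglyMeasurable_const)
      (Eventually.of_forall fun _ _ => by simp) (fun _ => tendsto_const_nhds)
    simpa using this
  have hpos := integral_exp_pos hint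
  -- The limiting mass is positive, so the masses are positive for large n.
  have hmicro : ∀ᶠ n in atTop, 3 ≤ n ∧
      0 < ∫ z, marginalWeight β E₀ (effectivePotential HA C) (Module.finrank ℝ W) n z :=
    (eventually_ge_atTop 3).and (hmass.eventually (lt_mem_nhds hpos))
  refine ⟨hG, hcan, ?_, fun φ => ?_⟩
  · filter_upwards [hmicro] with n ⟨hn, hn'⟩
    obtain ⟨h1, h2⟩ := pdelta_HtotalOn hHAc (hCn n) (by rw [hdim]; omega)
    refine ⟨h1, ?_, (integral_microcanonicalX hβ hHAc (hCn n) hn (hdim n) hint hn').1⟩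
    simp_rw [h2, HtotalOn_eq_shiftedEnergy HA C (hCn n)]
    exact isDisintegration_shellMeasure hV (continuous_bathCenter C (hCn n)) (by rw [hdim]; omega)
  · have hA : ∀ z, Tendsto (fun n : ℕ => fibreAverage C ι (W ⊔ Ξ n)
        (fun z => shellRadius ((n : ℝ) / (2 * β) + E₀) (effectivePotential HA C z)) φ z) atTop
        (𝓝 (∫ y, φ (z, -ι (C z) + y) ∂(centeredGaussian (bathCov β ι)))) := by
      intro z
      have hψ : Continuous fun y => φ (z, -ι (C z) + y) := by fun_prop
      have hYm' : Measurable fun ξ => √β⁻¹ • Y ξ := hYm.const_smul _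
      rw [hGeq, integral_map hYm'.aemeasurable hψ.aestronglyMeasurable]
      exact tendsto_integral_sphereUniform ι e (fun n => W ⊔ Ξ n) B hB hY
        (tendsto_shellRadius_div_sqrt β E₀ (effectivePotential HA C z) (Module.finrank ℝ W)) hψ
        (fun y => φ.norm_coe_le_norm _)
    have hnum := tendsto_integral_marginalWeight_mul hV hint (Module.finrank ℝ W) (M := ‖φ‖)
      (by
        filter_upwards [eventually_ge_atTop 1] with n hn
        exact aestronglyMeasurable_fibreAverage (hnt n hn)
          (continuous_shellRadius.comp (continuous_const.prodMk hV)) φ.continuous)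
      (by
        filter_upwards [eventually_ge_atTop 1] with n hn
        exact norm_fibreAverage_le (hnt n hn) _ φ.norm_coe_le_norm) hA
    -- The normalization and the numerator converge separately, and the limit of the former is
    -- nonzero.
    have hlim := (hmass.inv₀ hpos.ne').mul hnum
    rw [hcanint]
    simp_rw [hexp, mul_assoc, integral_const_mul] at hlim
    rw [mul_inv, mul_assoc, mul_left_comm, inv_mul_cancel_left₀ (Real.exp_pos _).ne'] at hlim
    refine hlim.congr' ?_
    filter_upwards [hmicro] with n ⟨hn, hn'⟩
    exact ((integral_microcanonicalX hβ hHAc (hCn n) hn (hdim n) hint hn').2 φ).symm
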